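/- **Setting.** Indices $j$ are read modulo $2$. For $j=0,1$ let $I_j$ be a set with a base point $\iota_j$ such that $I'_j=I_j\setminus\{\iota_j\}$ is nonempty, and let $\Gamma_j\le \mathrm{Sym}(I_j)$ be a transitive permutation group with point stabilizer $\Gamma'_j=(\Gamma_j)_{\iota_j}$. Assume that $\Gamma'_0$ and $\Gamma'_1$ are not both trivial. (The sets $I_j$ may be infinite.) **The group $G[\Gamma_0,\Gamma_1]$.** Consider symbols $g_j(\sigma)$ with $\sigma\in\Gamma_j$, and $h_j(i_j,\dots,i_{j+n};\sigma)$ with $n\ge 0$, $i_k\in I'_{k \bmod 2}$ and $\sigma\in\Gamma'_{j+n+1}$, for $j=0,1$, and the following relations. * (R1) Each of the symbols $g_0(\sigma)$ $(\sigma\in\Gamma'_0)$ and $h_0(\dots;\cdot)$ commutes with each of the symbols $g_1(\sigma)$ $(\sigma\in\Gamma'_1)$ and $h_1(\dots;\cdot)$. * (R2) $h_j(s_j,\dots,s_{j+m};\sigma)$ and $h_j(i_j,\dots,i_{j+n};\sigma')$ commute if $0\le m\le n$ and $(s_j,\dots,s_{j+m})\ne(i_j,\dots,i_{j+m})$. *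 (R3) If $0\le m<n$, then $h_j(i_j,\dots,i_{j+m};\sigma)\,h_j(i_j,\dots,i_{j+n};\sigma')\,h_j(i_j,\dots,i_{j+m};\sigma)^{-1}=h_j(i_j,\dots,i_{j+m},\sigma(i_{j+m+1}),i_{j+m+2},\dots,i_{j+n};\sigma')$. * (R4) $\sigma\mapsto h_j(i_j,\dots,i_{j+m};\sigma)$ respects identity, products and inverses on $\Gamma'_{j+m+1}$. * (R5) $\sigma\mapsto g_j(\sigma)$ respects identity, products and inverses on $\Gamma_j$. * (R6) For $\sigma\in\Gamma_j$ the element $g_j(\sigma)\,h_j(i_j,\dots,i_{j+m};\sigma')\,g_j(\sigma)^{-1}$ equals $g_{j+1}(\sigma')$ if $\sigma(i_j)=\iota_j$ and $m=0$; it equals $h_{j+1}(i_{j+1},\dots,i_{j+m};\sigma')$ if $\sigma(i_j)=\iota_j$ and $m\ge1$; and it equals $h_j(\sigma(i_j),i_{j+1},\dots,i_{j+m};\sigma')$ if $\sigma(i_j)\neq\iota_j$. Let $H$ be the group generated by all symbols $h_0(\dots;\cdot)$, $h_1(\dots;\cdot)$ and the $g_0(\sigma)$, $g_1(\sigma)$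 with $\sigma\in\Gamma'_0$, respectively $\sigma\in\Gamma'_1$, subject to those of the relations (R1)–(R6) that involve only these symbols. For $j=0,1$ let $G_j$ be the group generated by the same symbols together with all $g_j(\sigma)$, $\sigma\in\Gamma_j$, subject to those of the relations that involve only these symbols. Let $G[\Gamma_0,\Gamma_1]=G_0*_H G_1$ be the amalgamated free product along the natural maps $H\to G_0$ and $H\to G_1$. **Inner amenability.** A group $G$ is inner amenable if there is a conjugation invariant, positive, finitely additive probability measure defined on all subsets of $G\setminus\{1\}$. **Theorem.** For all such $I_j,\iota_j,\Gamma_j$ $(j=0,1)$, the group $G[\Gamma_0,\Gamma_1]$ is not inner amenable. -/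

import Mathlib

universe u

/-! ## Inner amenability -/

/-- Conjugation by `g`, as a self-map of `G \ {1}`. -/
def conjNeOne {G : Type u} [Group G] (g : G) (x : {x : G // x ≠ 1}) : {x : G // x ≠ 1} :=
  ⟨g * x.1 * g⁻¹, fun h => x.2 (conj_eq_one_iff.mp h)⟩

/-- A (discrete) group `G` is inner amenable if there is a conjugation invariant, positive,
finitely additive probability measure, defined on all subsets of `G \ {1}`. -/
def InnerAmenable (G : Type u) [Group G] : Prop :=
  ∃ m : Set {x : G // x ≠ 1} → ℝ,
    (∀ A, 0 ≤ m A) ∧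
    m Set.univ = 1 ∧
    (∀ A B, Disjoint A B → m (A ∪ B) = m A + m B) ∧
    ∀ (g : G) (A), m (conjNeOne g '' A) = m A

/-! ## The amalgams `G[Γ₀, Γ₁]`

Indices `j : Fin 2` are read modulo `2`, so `j + 1` is the other index. -/

namespace Amalgam

variable {I : Fin 2 → Type u}

/-- `I'_j = I_j \ {ι_j}`. -/
abbrev Punctured (ι : ∀ j, I j) (j : Fin 2) : Type u := {i : I j // i ≠ ι j}

/-- `Γ'_j`, the stabilizer of `ι_j` in `Γ_j`. -/
def stab (ι : ∀ j, I j) (Γ : ∀ j, Subgroup (Equiv.Perm (I j))) (j : Fin 2) :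
    Subgroup (Equiv.Perm (I j)) :=
  Γ j ⊓ MulAction.stabilizer (Equiv.Perm (I j)) (ι j)

/-- `Word ι j t` is the type of finite, possibly empty, sequences `i_j, i_{j+1}, …, i_{j+n-1}`
with `i_k ∈ I'_{k mod 2}` and `j + n = t` modulo `2`. -/
inductive Word (ι : ∀ j, I j) : Fin 2 → Fin 2 → Type u
  | nil (j : Fin 2) : Word ι j j
  | cons {j t : Fin 2} (i : Punctured ι j) (w : Word ι (j + 1) t) : Word ι j t

namespace Word

variable {ι : ∀ j, I j}

def length : {j t : Fin 2} → Word ι j t → ℕ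
  | _, _, nil _ => 0
  | _, _, cons _ w => w.length + 1

def append : {j t s : Fin 2} → Word ι j t → Word ι t s → Word ι j s
  | _, _, _, nil _, v => v
  | _, _, _, cons i w, v => cons i (w.append v)

end Word

/-- The generators: `g j σ` is `g_j(σ)`, for `σ ∈ A_j`, and `h j i w σ` is `h_j(i, w; σ)`, where
`(i, w) = (i_j, i_{j+1}, …, i_{j+n})` is a nonempty sequence and `σ ∈ Γ'_{j+n+1}`.
The subgroups `A_j` will be either `Γ_j` or `Γ'_j`. -/
inductive Gen (ι : ∀ j, I j) (Γ A : ∀ j, Subgroup (Equiv.Perm (I j))) : Type u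
  | g (j : Fin 2) (σ : A j) : Gen ι Γ A
  | h (j : Fin 2) {t : Fin 2} (i : Punctured ι j) (w : Word ι (j + 1) t) (σ : stab ι Γ t) :
      Gen ι Γ A

variable (ι : ∀ j, I j) (Γ A B : ∀ j, Subgroup (Equiv.Perm (I j)))

/-- The generators that generate `Q_j`. -/
inductive Gen.InQ (j : Fin 2) : Gen ι Γ A → Prop
  | g (σ : A j) (hσ : (σ : Equiv.Perm (I j)) ∈ stab ι Γ j) : Gen.InQ j (.g j σ)
  | h {t : Fin 2} (i : Punctured ι j) (w : Word ι (j + 1) t) (σ : stab ι Γ t) :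
      Gen.InQ j (.h j i w σ)

/-- The element `g_j(σ)` of the free group. -/
def gF (j : Fin 2) (σ : A j) : FreeGroup (Gen ι Γ A) := FreeGroup.of (.g j σ)

/-- The element `h_j(i, w; σ)` of the free group. -/
def hF (j : Fin 2) {t : Fin 2} (i : Punctured ι j) (w : Word ι (j + 1) t) (σ : stab ι Γ t) :
    FreeGroup (Gen ι Γ A) := FreeGroup.of (.h j i w σ)

/-- The defining relations; `Rel ι Γ A a b` stands for the relation `a = b`. -/
inductive Rel : FreeGroup (Gen ι Γ A) → FreeGroup (Gen ι Γ A) → Prop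
  /-- The generators of `Q_0` commute with those of `Q_1`. -/
  | r1 (a b : Gen ι Γ A) (ha : Gen.InQ ι Γ A 0 a) (hb : Gen.InQ ι Γ A 1 b) :
      Rel (FreeGroup.of a * FreeGroup.of b) (FreeGroup.of b * FreeGroup.of a)
  /-- `h_j(s_j, …, s_{j+m}; σ)` commutes with `h_j(i_j, …, i_{j+m}, …, i_{j+n}; σ')` if
  `(s_j, …, s_{j+m}) ≠ (i_j, …, i_{j+m})`. -/
  | r2 (j : Fin 2) {t r : Fin 2} (s i : Punctured ι j) (v w : Word ι (j + 1) t)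
      (hl : v.length = w.length) (hne : (s, v) ≠ (i, w)) (x : Word ι t r)
      (σ : stab ι Γ t) (σ' : stab ι Γ r) :
      Rel (hF ι Γ A j s v σ * hF ι Γ A j i (w.append x) σ')
        (hF ι Γ A j i (w.append x) σ' * hF ι Γ A j s v σ)
  /-- Conjugation by `h_j(i_j, …, i_{j+m}; σ)` maps
  `h_j(i_j, …, i_{j+m}, k, …, i_{j+n}; σ')` to `h_j(i_j, …, i_{j+m}, σ(k), …, i_{j+n}; σ')`. -/
  | r3 (j : Fin 2) {t r : Fin 2} (i : Punctured ι j) (w : Word ι (j + 1) t) (σ : stab ι Γ t)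
      (k k' : Punctured ι t) (hk : (σ : Equiv.Perm (I t)) k.1 = k'.1) (x : Word ι (t + 1) r)
      (σ' : stab ι Γ r) :
      Rel (hF ι Γ A j i w σ * hF ι Γ A j i (w.append (.cons k x)) σ' * (hF ι Γ A j i w σ)⁻¹)
        (hF ι Γ A j i (w.append (.cons k' x)) σ')
  | r4_one (j : Fin 2) {t : Fin 2} (i : Punctured ι j) (w : Word ι (j + 1) t) :
      Rel (hF ι Γ A j i w 1) 1
  | r4_mul (j : Fin 2) {t : Fin 2} (i : Punctured ι j) (w : Word ι (j + 1) t)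
      (σ' σ : stab ι Γ t) :
      Rel (hF ι Γ A j i w σ' * hF ι Γ A j i w σ) (hF ι Γ A j i w (σ' * σ))
  | r4_inv (j : Fin 2) {t : Fin 2} (i : Punctured ι j) (w : Word ι (j + 1) t) (σ : stab ι Γ t) :
      Rel (hF ι Γ A j i w σ)⁻¹ (hF ι Γ A j i w σ⁻¹)
  | r5_one (j : Fin 2) : Rel (gF ι Γ A j 1) 1
  | r5_mul (j : Fin 2) (σ σ' : A j) :
      Rel (gF ι Γ A j σ * gF ι Γ A j σ') (gF ι Γ A j (σ * σ'))
  | r5_inv (j : Fin 2) (σ : A j) : Rel (gF ι Γ A j σ)⁻¹ (gF ι Γ A j σ⁻¹)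
  /-- `g_j(σ) h_j(i; σ') g_j(σ)⁻¹ = g_{j+1}(σ')` if `σ(i) = ι_j`. -/
  | r6_nil (j : Fin 2) (σ : A j) (i : Punctured ι j) (hi : (σ : Equiv.Perm (I j)) i.1 = ι j)
      (σ' : stab ι Γ (j + 1)) (hσ' : (σ' : Equiv.Perm (I (j + 1))) ∈ A (j + 1)) :
      Rel (gF ι Γ A j σ * hF ι Γ A j i (.nil (j + 1)) σ' * (gF ι Γ A j σ)⁻¹)
        (gF ι Γ A (j + 1) ⟨σ', hσ'⟩)
  /-- `g_j(σ) h_j(i, k, x; σ') g_j(σ)⁻¹ = h_{j+1}(k, x; σ')` if `σ(i) = ι_j`. -/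
  | r6_cons (j : Fin 2) {t : Fin 2} (σ : A j) (i : Punctured ι j)
      (hi : (σ : Equiv.Perm (I j)) i.1 = ι j) (k : Punctured ι (j + 1))
      (x : Word ι (j + 1 + 1) t) (σ' : stab ι Γ t) :
      Rel (gF ι Γ A j σ * hF ι Γ A j i (.cons k x) σ' * (gF ι Γ A j σ)⁻¹)
        (hF ι Γ A (j + 1) k x σ')
  /-- `g_j(σ) h_j(i, w; σ') g_j(σ)⁻¹ = h_j(σ(i), w; σ')` if `σ(i) ≠ ι_j`. -/
  | r6_ne (j : Fin 2) {t : Fin 2} (σ : A j) (i i' : Punctured ι j)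
      (hi : (σ : Equiv.Perm (I j)) i.1 = i'.1) (w : Word ι (j + 1) t) (σ' : stab ι Γ t) :
      Rel (gF ι Γ A j σ * hF ι Γ A j i w σ' * (gF ι Γ A j σ)⁻¹) (hF ι Γ A j i' w σ')

/-- The relators. -/
def rels : Set (FreeGroup (Gen ι Γ A)) := {r | ∃ a b, Rel ι Γ A a b ∧ r = a * b⁻¹}

/-- The group generated by all `h_j(i_j, …, i_{j+n}; σ)` and by the `g_j(σ)` with `σ ∈ A_j`,
subject to the defining relations. -/
abbrev Grp : Type u := PresentedGroup (rels ι Γ A)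

variable {A B}

/-- The inclusion of sets of generators. -/
def Gen.incl (hAB : ∀ j, A j ≤ B j) : Gen ι Γ A → Gen ι Γ B
  | .g j σ => .g j (Subgroup.inclusion (hAB j) σ)
  | .h j i w σ => .h j i w σ

theorem Gen.InQ.incl (hAB : ∀ j, A j ≤ B j) {j : Fin 2} {a : Gen ι Γ A}
    (ha : Gen.InQ ι Γ A j a) : Gen.InQ ι Γ B j (Gen.incl ι Γ hAB a) := by
  cases ha with
  | g σ hσ => exact .g _ hσ
  | h i w σ => exact .h i w σ

theorem Rel.incl (hAB : ∀ j, A j ≤ B j) {a b : FreeGroup (Gen ι Γ A)} (hab : Rel ι Γ A a b) :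
    Rel ι Γ B (FreeGroup.map (Gen.incl ι Γ hAB) a) (FreeGroup.map (Gen.incl ι Γ hAB) b) := by
  cases hab <;>
    simp only [map_mul, map_inv, map_one, gF, hF, FreeGroup.map.of, Gen.incl]
  case r1 a b ha hb => exact .r1 _ _ (ha.incl ι Γ hAB) (hb.incl ι Γ hAB)
  case r2 j t r s i v w hl hne x σ σ' => exact .r2 j s i v w hl hne x σ σ'
  case r3 j t r i w σ k k' hk x σ' => exact .r3 j i w σ k k' hk x σ'
  case r4_one j t i w => exact .r4_one j i w
  case r4_mul j t i w σ' σ => exact .r4_mul j i w σ' σ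
  case r4_inv j t i w σ => exact .r4_inv j i w σ
  case r5_one j => exact .r5_one j
  case r5_mul j σ σ' => exact .r5_mul j _ _
  case r5_inv j σ => exact .r5_inv j _
  case r6_nil j σ i hi σ' hσ' => exact .r6_nil j (Subgroup.inclusion (hAB j) σ) i hi σ' (hAB _ hσ')
  case r6_cons j t σ i hi k x σ' => exact .r6_cons j (Subgroup.inclusion (hAB j) σ) i hi k x σ'
  case r6_ne j t σ i i' hi w σ' => exact .r6_ne j (Subgroup.inclusion (hAB j) σ) i i' hi w σ'

/-- The homomorphism induced by the inclusion of sets of generators. -/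
def Grp.incl (hAB : ∀ j, A j ≤ B j) : Grp ι Γ A →* Grp ι Γ B :=
  PresentedGroup.toGroup (rels := rels ι Γ A)
    (f := fun a => PresentedGroup.of (rels := rels ι Γ B) (Gen.incl ι Γ hAB a)) (by
      rintro r ⟨a, b, hab, rfl⟩
      have hlift : FreeGroup.lift
          (fun a => PresentedGroup.of (rels := rels ι Γ B) (Gen.incl ι Γ hAB a)) =
          (PresentedGroup.mk (rels ι Γ B)).comp (FreeGroup.map (Gen.incl ι Γ hAB)) := by
        ext a
        simp [PresentedGroup.of]
      rw [hlift]
      exact (PresentedGroup.one_of_mem ⟨_, _, hab.incl ι Γ hAB, by simp⟩))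

/-- The edge group `H = ⟨Q_0, Q_1⟩`: its generators are those of `Q_0` and `Q_1`. -/
abbrev EdgeGroup : Type u := Grp ι Γ (stab ι Γ)

/-- For the vertex group `G_j`, the elements `g_j(σ)` are there for all `σ ∈ Γ_j`, but
`g_{j+1}(σ)` only for `σ ∈ Γ'_{j+1}`. -/
def vertexPerm (j : Fin 2) (k : Fin 2) : Subgroup (Equiv.Perm (I k)) :=
  if k = j then Γ k else stab ι Γ k

theorem stab_le_vertexPerm (j k : Fin 2) : stab ι Γ k ≤ vertexPerm ι Γ j k := by
  unfold vertexPerm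
  split
  · exact inf_le_left
  · exact le_rfl

/-- The vertex group `G_j = ⟨H ∪ {g_j(σ) | σ ∈ Γ_j \ Γ'_j}⟩`. -/
abbrev VertexGroup (j : Fin 2) : Type u := Grp ι Γ (vertexPerm ι Γ j)

/-- The map `H → G_j`. -/
def edgeToVertex (j : Fin 2) : EdgeGroup ι Γ →* VertexGroup ι Γ j :=
  Grp.incl ι Γ (stab_le_vertexPerm ι Γ j)

/-- The amalgamated free product `G[Γ_0, Γ_1] = G_0 *_H G_1`. -/
abbrev AmalgamGroup : Type u := Monoid.PushoutI (edgeToVertex ι Γ)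

end Amalgam

/-! The group acts on a tree that consists of two half trees whose roots `base 0` and `base 1` are
joined by an edge. At a vertex of type `t` the edges carry the labels `I t`. The element
$g_j(\sigma)$ permutes the branches at `base j` by `σ` and moves each of them rigidly;
$h_j(w;\sigma)$ does the same around the vertex `w` of a half tree.

A rotation around `base j` preserves the labels at all other vertices, so every group element
preserves the labels at all but finitely many vertices (`finite_singularSet`). A label determines
the neighbour, so a fixed vertex with a moved neighbour is one of these exceptions, and
`fixedBoundary` is finite. The action is faithful (`toPerm_injective`): for the edge group by
induction on the length of words, and outside it because a reduced word moves a whole half tree off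
a base vertex.

Now let `m` be an invariant mean. Call `g` directed into a half tree `U` if it moves the boundary
vertex of `U` into `U` while fixing no vertex, or if it fixes some vertex and at least half of its
finite nonempty fixed boundary lies in `U`. Every nontrivial element is directed into `U` or into
its complement, but none into three disjoint half trees. Conjugation by `h` carries the elements
directed into `U` to elements directed into `h • U`. A nontrivial stabilizer gives the tree enough
branching for a ping-pong argument, which yields infinitely many disjoint translates of both half
trees (`disjoint_smul_of_pingPong`). So both sets of directed elements have arbitrarily small
measure, although they cover everything: a contradiction. -/

/-! ### Finitely additive measures -/

theorem sum_le_two_of_finitelyAdditive {X : Type*} {m : Set X → ℝ} (hpos : ∀ A, 0 ≤ m A)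
    (huniv : m Set.univ = 1) (hadd : ∀ A B, Disjoint A B → m (A ∪ B) = m A + m B)
    {D : ℕ → Set X} (hD : ∀ i j k, i < j → j < k → D i ∩ D j ∩ D k = ∅) (n : ℕ) :
    ∑ i ∈ Finset.range n, m (D i) ≤ 2 := by
  have hempty : m ∅ = 0 := by
    have := hadd ∅ ∅ (by simp)
    simp only [Set.union_self] at this
    linarith
  have hle : ∀ A, m A ≤ 1 := fun A => by
    have := hadd A Aᶜ disjoint_compl_right
    rw [Set.union_compl_self, huniv] at this
    linarith [hpos Aᶜ]
  have hdisj : ∀ (E : ℕ → Set X), (∀ i j, i < j → Disjoint (E i) (E j)) →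
      ∀ n, ∑ i ∈ Finset.range n, m (E i) = m (⋃ i < n, E i) := by
    intro E hE n
    induction n with
    | zero => simp [hempty]
    | succ n ih =>
      rw [Finset.sum_range_succ, ih, Set.biUnion_lt_succ, hadd]
      exact Set.disjoint_iUnion₂_left.mpr fun i hi => hE i n hi
  -- Split each set into the points not met before and the points met before. Both families are
  -- disjoint, the second since no point lies in three of the sets, so each has total measure at
  -- most 1.
  have hsplit : ∀ i, m (D i) = m (D i \ ⋃ k < i, D k) + m (D i ∩ ⋃ k < i, D k) := by
    intro i
    rw [← hadd _ _ Set.disjoint_sdiff_inter, Set.sdiff_union_inter]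
  simp_rw [hsplit]
  rw [Finset.sum_add_distrib, hdisj _ _ n, hdisj _ _ n]
  · linarith [hle (⋃ i < n, D i \ ⋃ k < i, D k), hle (⋃ i < n, D i ∩ ⋃ k < i, D k)]
  · intro i j hij
    rw [Set.disjoint_left]
    rintro x ⟨_, hx⟩ ⟨hxj, _⟩
    simp only [Set.mem_iUnion] at hx
    obtain ⟨k, hk, hxk⟩ := hx
    exact Set.notMem_empty x (hD k i j hk hij ▸ ⟨⟨hxk, by assumption⟩, hxj⟩)
  · intro i j hij
    rw [Set.disjoint_left]
    rintro x ⟨hxi, _⟩ ⟨_, hx⟩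
    exact hx (Set.mem_biUnion (show i ∈ {k | k < j} from hij) hxi)

/-! ### Distances in graphs with a cut vertex -/

namespace SimpleGraph

variable {V : Type*} {T : SimpleGraph V}

theorem Walk.mem_support_of_exit {U : Set V} {a : V}
    (hU : ∀ x ∈ U, ∀ y ∉ U, T.Adj x y → x = a) {x y : V} (p : T.Walk x y) (hx : x ∈ U)
    (hy : y ∉ U) : a ∈ p.support := by
  induction p with
  | nil => exact absurd hx hy
  | @cons u v w h p ih =>
    rw [Walk.support_cons, List.mem_cons]
    by_cases hv : v ∈ U
    · exact Or.inr (ih hv hy)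
    · exact Or.inl (hU u hx v hv h).symm

/-- A shortest walk that leaves `U` has to pass through `a`, so it can be cut there. -/
theorem Connected.dist_eq_add_of_exit (hT : T.Connected) {U : Set V} {a : V}
    (hU : ∀ x ∈ U, ∀ y ∉ U, T.Adj x y → x = a) {x y : V} (hx : x ∈ U) (hy : y ∉ U) :
    T.dist x y = T.dist x a + T.dist a y := by
  classical
  refine le_antisymm hT.dist_triangle ?_
  obtain ⟨p, hp⟩ := hT.exists_walk_length_eq_dist x y
  have ha := p.mem_support_of_exit hU hx hy
  rw [← hp, ← p.take_spec ha, Walk.length_append]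
  exact add_le_add (dist_le _) (dist_le _)

theorem dist_smul {G : Type*} [Group G] [MulAction G V] (hT : T.Connected)
    (hadj : ∀ (g : G) x y, T.Adj x y → T.Adj (g • x) (g • y)) (g : G) (x y : V) :
    T.dist (g • x) (g • y) = T.dist x y := by
  have key : ∀ (g : G) x y, T.dist (g • x) (g • y) ≤ T.dist x y := by
    intro g x y
    obtain ⟨p, hp⟩ := hT.exists_walk_length_eq_dist x y
    rw [← hp]
    let f : T →g T := ⟨fun x => g • x, fun h => hadj g _ _ h⟩
    exact (dist_le (p.map f)).trans (by simp)
  refine le_antisymm (key g x y) ?_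
  simpa using key g⁻¹ (g • x) (g • y)

end SimpleGraph

/-! ### Invariant means and actions on trees -/

section TreeAction

open scoped Pointwise

variable {G : Type*} [Group G] {V : Type*} [MulAction G V] (T : SimpleGraph V)

/-- The fixed vertices of `g` with a neighbour that `g` moves. -/
def fixedBoundary (g : G) : Set V := {x | g • x = x ∧ ∃ y, T.Adj x y ∧ g • y ≠ y}

variable {T}

theorem mem_fixedBoundary_conj (hadj : ∀ (g : G) x y, T.Adj x y → T.Adj (g • x) (g • y)) (h g : G)
    (x : V) (hx : x ∈ fixedBoundary T g) : h • x ∈ fixedBoundary T (h * g * h⁻¹) := by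
  obtain ⟨hx, y, hxy, hy⟩ := hx
  refine ⟨by simp [mul_smul, hx], h • y, hadj h _ _ hxy, fun hc => hy ?_⟩
  simpa [mul_smul] using hc

theorem fixedBoundary_conj (hadj : ∀ (g : G) x y, T.Adj x y → T.Adj (g • x) (g • y)) (h g : G) :
    fixedBoundary T (h * g * h⁻¹) = h • fixedBoundary T g := by
  ext x
  rw [Set.mem_smul_set_iff_inv_smul_mem]
  constructor
  · intro hx
    simpa [mul_assoc] using mem_fixedBoundary_conj hadj h⁻¹ _ x hx
  · intro hx
    simpa using mem_fixedBoundary_conj hadj h g _ hx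

/-- By faithfulness some vertex is moved; a walk to it from a fixed vertex crosses from fixed to
moved vertices. -/
theorem fixedBoundary_nonempty [FaithfulSMul G V] (hT : T.Connected) {g : G} (hg : g ≠ 1)
    (hfix : ∃ x : V, g • x = x) : (fixedBoundary T g).Nonempty := by
  obtain ⟨x, hx⟩ := hfix
  obtain ⟨y, hy⟩ : ∃ y : V, g • y ≠ y := by
    by_contra! hc
    exact hg (FaithfulSMul.eq_of_smul_eq_smul (α := V) fun y => by rw [hc, one_smul])
  by_contra hne
  rw [Set.not_nonempty_iff_eq_empty, Set.eq_empty_iff_forall_notMem] at hne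
  obtain ⟨p⟩ := hT x y
  induction p with
  | nil => exact hy hx
  | @cons u v w h p ih =>
    refine ih ?_ hy
    by_contra hv
    exact hne u ⟨hx, v, h, hv⟩

variable (T) in
/-- For a half tree `U` with boundary vertex `a`: the elements without fixed vertices that map `a`
into `U`, and the elements with fixed vertices that have at least half of their fixed boundary
in `U`. -/
def directedInto (U : Set V) (a : V) : Set {g : G // g ≠ 1} :=
  {g | ((∀ x : V, g.1 • x ≠ x) ∧ g.1 • a ∈ U) ∨
    ((∃ x : V, g.1 • x = x) ∧ (fixedBoundary T g.1).ncard ≤ 2 * (fixedBoundary T g.1 ∩ U).ncard)}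

/-- Both alternatives in `directedInto` are equivariant, since conjugation translates fixed vertices
and fixed boundaries. The inclusion suffices, as only disjointness has to be transported. -/
theorem conjNeOne_image_directedInto {G : Type*} [Group G] [MulAction G V]
    (hadj : ∀ (g : G) x y, T.Adj x y → T.Adj (g • x) (g • y)) (h : G) (U : Set V) (a : V) :
    conjNeOne h '' directedInto T U a ⊆ directedInto T (h • U) (h • a) := by
  rintro _ ⟨g, hg, rfl⟩
  rcases hg with ⟨hfix, ha⟩ | ⟨⟨x, hx⟩, hcard⟩
  · refine Or.inl ⟨fun x hx => hfix (h⁻¹ • x) ?_, ?_⟩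
    · rw [eq_inv_smul_iff]
      simpa [conjNeOne, mul_smul] using hx
    · simpa [conjNeOne, mul_smul] using ha
  · refine Or.inr ⟨⟨h • x, by simp [conjNeOne, mul_smul, hx]⟩, ?_⟩
    simpa only [conjNeOne, fixedBoundary_conj hadj, ← Set.smul_set_inter, Set.ncard_smul_set]
      using hcard

/-- If `g` fixes a vertex, three disjoint subsets cannot each contain at least half of a finite
nonempty fixed boundary. If it fixes none, two of the half trees already lead to a contradiction. -/
theorem directedInto_inter_eq_empty [FaithfulSMul G V] (hT : T.Connected)
    (hadj : ∀ (g : G) x y, T.Adj x y → T.Adj (g • x) (g • y))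
    (hfin : ∀ g : G, (fixedBoundary T g).Finite) (U : Fin 3 → Set V) (a : Fin 3 → V)
    (ha : ∀ i, a i ∈ U i) (hexit : ∀ i, ∀ x ∈ U i, ∀ y ∉ U i, T.Adj x y → x = a i)
    (hdisj : ∀ i j, i ≠ j → Disjoint (U i) (U j)) :
    directedInto (G := G) T (U 0) (a 0) ∩ directedInto T (U 1) (a 1) ∩
      directedInto T (U 2) (a 2) = ∅ := by
  rw [Set.eq_empty_iff_forall_notMem]
  rintro g ⟨⟨h0, h1⟩, h2⟩
  by_cases hfix : ∃ x : V, g.1 • x = x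
  · have hcard : ∀ i, (g ∈ directedInto T (U i) (a i)) →
        (fixedBoundary T g.1).ncard ≤ 2 * (fixedBoundary T g.1 ∩ U i).ncard := by
      rintro i (⟨hc, _⟩ | ⟨_, h⟩)
      · exact absurd hfix (by push Not; exact hc)
      · exact h
    have hS := hfin g.1
    have hpos : 0 < (fixedBoundary T g.1).ncard :=
      (Set.ncard_pos hS).mpr (fixedBoundary_nonempty hT g.2 hfix)
    have hsub : (fixedBoundary T g.1 ∩ U 0 ∪ fixedBoundary T g.1 ∩ U 1 ∪ fixedBoundary T g.1 ∩ U 2).ncard ≤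
        (fixedBoundary T g.1).ncard := by
      refine Set.ncard_le_ncard ?_ hS
      simp
    have hd : ∀ i j, i ≠ j → Disjoint (fixedBoundary T g.1 ∩ U i) (fixedBoundary T g.1 ∩ U j) :=
      fun i j hij => (hdisj i j hij).mono Set.inter_subset_right Set.inter_subset_right
    rw [Set.ncard_union_eq _ ((hS.inter_of_left _).union (hS.inter_of_left _))
        (hS.inter_of_left _),
      Set.ncard_union_eq (hd 0 1 (by decide)) (hS.inter_of_left _) (hS.inter_of_left _)] at hsub
    · have := hcard 0 h0
      have := hcard 1 h1
      have := hcard 2 h2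
      omega
    · exact (hd 0 2 (by decide)).union_left (hd 1 2 (by decide))
  · push Not at hfix
    have hmem : ∀ i, (g ∈ directedInto T (U i) (a i)) → g.1 • a i ∈ U i := by
      rintro i (⟨_, h⟩ | ⟨⟨x, hx⟩, _⟩)
      · exact h
      · exact absurd hx (hfix x)
    -- Geodesics between disjoint half trees run through `a 0` and `a 1`. Hence the distance from `g
    -- • a 0` to `g • a 1` is that from `a 0` to `a 1` plus both displacements. As `g` is an
    -- isometry, the displacements vanish.
    have hd := hdisj 0 1 (by decide)
    have e1 := hT.dist_eq_add_of_exit (hexit 0) (hmem 0 h0)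
      (fun h => hd.notMem_of_mem_left h (hmem 1 h1))
    have e2 := hT.dist_eq_add_of_exit (hexit 1) (hmem 1 h1)
      (fun h => hd.notMem_of_mem_left (ha 0) h)
    rw [SimpleGraph.dist_smul hT hadj, T.dist_comm (u := a 0) (v := g.1 • a 1), e2,
      T.dist_comm (u := a 1) (v := a 0)] at e1
    have : T.dist (g.1 • a 0) (a 0) = 0 := by omega
    exact hfix _ (hT.dist_eq_zero_iff.mp this)

/-- The conjugates by the `h i` have equal measure and are directed into disjoint half trees, so no
point lies in three of them. -/
theorem measure_directedInto_le {G : Type*} [Group G] [MulAction G V] [FaithfulSMul G V]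
    (hT : T.Connected)
    (hadj : ∀ (g : G) x y, T.Adj x y → T.Adj (g • x) (g • y))
    (hfin : ∀ g : G, (fixedBoundary T g).Finite) {m : Set {g : G // g ≠ 1} → ℝ}
    (hpos : ∀ A, 0 ≤ m A) (huniv : m Set.univ = 1)
    (hadd : ∀ A B, Disjoint A B → m (A ∪ B) = m A + m B)
    (hinv : ∀ (g : G) (A), m (conjNeOne g '' A) = m A) {U : Set V} {a : V} (ha : a ∈ U)
    (hexit : ∀ x ∈ U, ∀ y ∉ U, T.Adj x y → x = a) (h : ℕ → G)
    (hdisj : ∀ i j, i < j → Disjoint (h i • U) (h j • U)) (n : ℕ) :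
    n * m (directedInto T U a) ≤ 2 := by
  have key := sum_le_two_of_finitelyAdditive hpos huniv hadd
    (D := fun i => conjNeOne (h i) '' directedInto T U a) ?_ n
  · simpa [hinv] using key
  · intro i j k hij hjk
    rw [← Set.subset_empty_iff]
    let l : Fin 3 → ℕ := ![i, j, k]
    have hl : StrictMono l := by
      intro p q hpq
      fin_cases p <;> fin_cases q <;> simp [l] at hpq ⊢ <;> omega
    have := directedInto_inter_eq_empty (G := G) hT hadj hfin (fun p => h (l p) • U)
      (fun p => h (l p) • a) (fun p => Set.smul_mem_smul_set ha) ?_ ?_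
    · rw [← this]
      exact Set.inter_subset_inter (Set.inter_subset_inter
        (conjNeOne_image_directedInto hadj _ _ _) (conjNeOne_image_directedInto hadj _ _ _))
        (conjNeOne_image_directedInto hadj _ _ _)
    · intro p x hx y hy hxy
      rw [Set.mem_smul_set_iff_inv_smul_mem] at hx hy
      rw [← hexit _ hx _ hy (hadj _ _ _ hxy), smul_inv_smul]
    · intro p q hpq
      rcases lt_or_gt_of_ne hpq with hlt | hlt
      · exact hdisj _ _ (hl hlt)
      · exact (hdisj _ _ (hl hlt)).symm

/-- A group acting faithfully and without inversions on a tree is not inner amenable if all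
fixed boundaries are finite and the half trees at some edge have infinitely many disjoint translates. -/
theorem not_innerAmenable_of_tree_action {G : Type*} [Group G] [MulAction G V] [FaithfulSMul G V]
    (hT : T.Connected)
    (hadj : ∀ (g : G) x y, T.Adj x y → T.Adj (g • x) (g • y))
    (hfin : ∀ g : G, (fixedBoundary T g).Finite) {U : Set V} {a b : V} (ha : a ∈ U) (hb : b ∉ U)
    (hcross : ∀ x ∈ U, ∀ y ∉ U, T.Adj x y → x = a ∧ y = b) (hab : T.Adj a b)
    (hinversion : ∀ g : G, g • a ≠ b) (h h' : ℕ → G)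
    (hdisj : ∀ i j, i < j → Disjoint (h i • U) (h j • U))
    (hdisj' : ∀ i j, i < j → Disjoint (h' i • Uᶜ) (h' j • Uᶜ)) : ¬ InnerAmenable G := by
  rintro ⟨m, hpos, huniv, hadd, hinv⟩
  -- Five translates bound each measure by 2/5, and 2/5 + 2/5 < 1; four would not suffice.
  have h1 := measure_directedInto_le hT hadj hfin hpos huniv hadd hinv ha
    (fun x hx y hy hxy => (hcross x hx y hy hxy).1) h hdisj 5
  have h2 := measure_directedInto_le hT hadj hfin hpos huniv hadd hinv (U := Uᶜ) hb
    (fun x hx y hy hxy => (hcross y (not_not.mp hy) x hx hxy.symm).2) h' hdisj' 5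
  have hcover : directedInto T U a ∪ directedInto T Uᶜ b = (Set.univ : Set {g : G // g ≠ 1}) := by
    rw [Set.eq_univ_iff_forall]
    intro g
    by_cases hfix : ∃ x : V, g.1 • x = x
    · have := Set.ncard_inter_add_ncard_sdiff_eq_ncard (fixedBoundary T g.1) U (hfin g.1)
      rw [Set.sdiff_eq] at this
      rcases le_total (fixedBoundary T g.1 ∩ U).ncard (fixedBoundary T g.1 ∩ Uᶜ).ncard with hle | hle
      · exact Or.inr (Or.inr ⟨hfix, by omega⟩)
      · exact Or.inl (Or.inr ⟨hfix, by omega⟩)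
    · push Not at hfix
      -- If neither alternative holds, `g` maps the edge from `b` to `a` to an edge that leaves `U`,
      -- that is, it inverts the edge.
      by_cases hgb : g.1 • b ∈ U
      · by_cases hga : g.1 • a ∈ U
        · exact Or.inl (Or.inl ⟨hfix, hga⟩)
        · exact absurd (hcross _ hgb _ hga (hadj _ _ _ hab.symm)).2 (hinversion _)
      · exact Or.inr (Or.inl ⟨hfix, hgb⟩)
  have hle : m (directedInto T U a ∪ directedInto T Uᶜ b) ≤
      m (directedInto T U a) + m (directedInto T Uᶜ b) := by
    rw [← Set.union_sdiff_self, hadd _ _ Set.disjoint_sdiff_right]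
    have := hadd _ _ (Set.disjoint_sdiff_inter
      (s := directedInto (G := G) T Uᶜ b) (t := directedInto T U a))
    rw [Set.sdiff_union_inter] at this
    linarith [hpos (directedInto (G := G) T Uᶜ b ∩ directedInto T U a)]
  rw [hcover, huniv] at hle
  norm_num at h1 h2
  linarith

end TreeAction

/-! ### The vertices of the tree and their permutations -/

namespace Amalgam

variable {I : Fin 2 → Type u} (ι : ∀ j, I j)

/-! ### Half trees -/

/-- The vertices of the half tree that starts at index `j`. -/
def HalfTree (j : Fin 2) : Type u := Σ t, Word ι j t

variable {ι}

def HalfTree.root (j : Fin 2) : HalfTree ι j := ⟨j, .nil j⟩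

def HalfTree.node {j : Fin 2} (i : Punctured ι j) (x : HalfTree ι (j + 1)) : HalfTree ι j :=
  ⟨x.1, .cons i x.2⟩

namespace HalfTree

@[elab_as_elim]
theorem cases {j : Fin 2} {p : HalfTree ι j → Prop} (root : p (root j))
    (node : ∀ i x, p (node i x)) (x : HalfTree ι j) : p x := by
  have key : ∀ t (w : Word ι j t), p ⟨t, w⟩ := by
    intro t w
    cases w with
    | nil => exact root
    | cons i w => exact node i ⟨t, w⟩
  exact key x.1 x.2

@[elab_as_elim]
theorem induction {p : ∀ {j : Fin 2}, HalfTree ι j → Prop} (root : ∀ j, p (root j))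
    (node : ∀ {j} (i : Punctured ι j) x, p x → p (node i x)) {j : Fin 2} (x : HalfTree ι j) :
    p x := by
  obtain ⟨t, w⟩ := x
  induction w with
  | nil j => exact root j
  | cons i w ih => exact node i ⟨_, w⟩ ih

@[simp] theorem root_ne_node {j : Fin 2} (i : Punctured ι j) (x : HalfTree ι (j + 1)) :
    root j ≠ node i x := by
  intro h
  exact absurd (congrArg (fun y : HalfTree ι j => y.2.length) h) (Nat.succ_ne_zero _).symm

@[simp] theorem node_ne_root {j : Fin 2} (i : Punctured ι j) (x : HalfTree ι (j + 1)) :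
    node i x ≠ root j := (root_ne_node i x).symm

@[simp] theorem node_inj {j : Fin 2} {i i' : Punctured ι j} {x x' : HalfTree ι (j + 1)} :
    node i x = node i' x' ↔ i = i' ∧ x = x' := by
  constructor
  · intro h
    obtain ⟨t, w⟩ := x
    obtain ⟨t', w'⟩ := x'
    have h2 : (⟨t, .cons i w⟩ : Σ t, Word ι j t) = ⟨t', .cons i' w'⟩ := h
    cases h2
    exact ⟨rfl, rfl⟩
  · rintro ⟨rfl, rfl⟩
    rfl

-- A half tree is its root together with one half tree of the other index for each label.
-- Permutations built on the left-hand side and transported along this equivalence are automatically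
-- bijective.
variable (ι) in
noncomputable def optionEquiv (j : Fin 2) :
    Option (Punctured ι j × HalfTree ι (j + 1)) ≃ HalfTree ι j :=
  Equiv.ofBijective (fun o => o.elim (root j) fun p => node p.1 p.2) (by
    constructor
    · rintro (_ | ⟨i, x⟩) (_ | ⟨i', x'⟩) h <;> simp_all
    · intro x
      induction x using cases with
      | root => exact ⟨none, rfl⟩
      | node i x => exact ⟨some (i, x), rfl⟩)

@[simp] theorem optionEquiv_none (j : Fin 2) : optionEquiv ι j none = root j := rfl

@[simp] theorem optionEquiv_some {j : Fin 2} (p : Punctured ι j × HalfTree ι (j + 1)) :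
    optionEquiv ι j (some p) = node p.1 p.2 := rfl

@[simp] theorem optionEquiv_symm_root (j : Fin 2) : (optionEquiv ι j).symm (root j) = none :=
  (Equiv.symm_apply_eq _).mpr rfl

@[simp] theorem optionEquiv_symm_node {j : Fin 2} (i : Punctured ι j) (x : HalfTree ι (j + 1)) :
    (optionEquiv ι j).symm (node i x) = some (i, x) :=
  (Equiv.symm_apply_eq _).mpr rfl

end HalfTree

open HalfTree

theorem perm_halfTree_ext {j : Fin 2} {p q : Equiv.Perm (HalfTree ι j)}
    (hroot : p (root j) = q (root j)) (hnode : ∀ i x, p (node i x) = q (node i x)) : p = q :=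
  Equiv.ext fun x => HalfTree.cases hroot hnode x

/-- A permutation of the branches at the root. -/
noncomputable def rootPerm (j : Fin 2) :
    Equiv.Perm (Punctured ι j) →* Equiv.Perm (HalfTree ι j) :=
  MonoidHom.mk' (fun σ => (optionEquiv ι j).permCongr
    (Equiv.optionCongr (Equiv.prodCongr σ (Equiv.refl _)))) (by
      intro σ τ
      apply perm_halfTree_ext <;> simp [Equiv.permCongr_apply])

@[simp] theorem rootPerm_root {j : Fin 2} (σ : Equiv.Perm (Punctured ι j)) :
    rootPerm j σ (root j) = root j := by
  simp [rootPerm, Equiv.permCongr_apply]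

@[simp] theorem rootPerm_node {j : Fin 2} (σ : Equiv.Perm (Punctured ι j)) (i : Punctured ι j)
    (x : HalfTree ι (j + 1)) : rootPerm j σ (node i x) = node (σ i) x := by
  simp [rootPerm, Equiv.permCongr_apply]

open Classical in
/-- A permutation that is supported in one branch. -/
noncomputable def nodePerm {j : Fin 2} (i : Punctured ι j) :
    Equiv.Perm (HalfTree ι (j + 1)) →* Equiv.Perm (HalfTree ι j) :=
  MonoidHom.mk' (fun p => (optionEquiv ι j).permCongr
    (Equiv.optionCongr (Equiv.Perm.prodExtendRight i p))) (by
      intro p q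
      apply perm_halfTree_ext
      · simp [Equiv.permCongr_apply]
      · intro k x
        by_cases h : k = i
        · subst h
          simp [Equiv.permCongr_apply]
        · simp [Equiv.permCongr_apply, Equiv.Perm.prodExtendRight_apply_ne (h := h)])

@[simp] theorem nodePerm_root {j : Fin 2} (i : Punctured ι j)
    (p : Equiv.Perm (HalfTree ι (j + 1))) : nodePerm i p (root j) = root j := by
  simp [nodePerm, Equiv.permCongr_apply]

@[simp] theorem nodePerm_node {j : Fin 2} (i : Punctured ι j)
    (p : Equiv.Perm (HalfTree ι (j + 1))) (x : HalfTree ι (j + 1)) :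
    nodePerm i p (node i x) = node i (p x) := by
  simp [nodePerm, Equiv.permCongr_apply]

open Classical in
theorem nodePerm_node_ne {j : Fin 2} {i k : Punctured ι j} (h : k ≠ i)
    (p : Equiv.Perm (HalfTree ι (j + 1))) (x : HalfTree ι (j + 1)) :
    nodePerm i p (node k x) = node k x := by
  simp [nodePerm, Equiv.permCongr_apply, Equiv.Perm.prodExtendRight_apply_ne (h := h)]

theorem commute_nodePerm {j : Fin 2} {i k : Punctured ι j} (h : k ≠ i)
    (p q : Equiv.Perm (HalfTree ι (j + 1))) : Commute (nodePerm i p) (nodePerm k q) := by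
  refine perm_halfTree_ext (by simp) fun l x => ?_
  by_cases h1 : l = i
  · subst h1
    simp [nodePerm_node_ne h.symm]
  · by_cases h2 : l = k
    · subst h2
      simp [nodePerm_node_ne h]
    · simp [nodePerm_node_ne h1, nodePerm_node_ne h2]

theorem rootPerm_conj_nodePerm {j : Fin 2} (σ : Equiv.Perm (Punctured ι j)) (i : Punctured ι j)
    (p : Equiv.Perm (HalfTree ι (j + 1))) :
    rootPerm j σ * nodePerm i p * (rootPerm j σ)⁻¹ = nodePerm (σ i) p := by
  rw [mul_inv_eq_iff_eq_mul]
  refine perm_halfTree_ext (by simp) fun l x => ?_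
  by_cases h1 : l = i
  · subst h1
    simp
  · simp [nodePerm_node_ne h1, nodePerm_node_ne (fun h => h1 (σ.injective h))]

/-! ### The tree -/

variable (ι) in
/-- The vertices of the tree. -/
def Vertex : Type u := Σ j, HalfTree ι j

namespace Vertex

/-- A vertex of a half tree as a vertex of the tree. -/
def of (j : Fin 2) (x : HalfTree ι j) : Vertex ι := ⟨j, x⟩

-- `base 0` and `base 1` are the ends of the edge whose two sides the edge group preserves.
variable (ι) in
def base (j : Fin 2) : Vertex ι := of j (root j)

open Classical in
/-- The copy of `x` that is attached to the vertex `base j` along the edge with label `i`. -/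
noncomputable def branch {j : Fin 2} (i : I j) (x : HalfTree ι (j + 1)) : Vertex ι :=
  if h : i = ι j then of (j + 1) x else of j (node ⟨i, h⟩ x)

@[simp] theorem branch_base {j : Fin 2} (x : HalfTree ι (j + 1)) :
    branch (ι j) x = of (j + 1) x := by simp [branch]

@[simp] theorem branch_punctured {j : Fin 2} (i : Punctured ι j) (x : HalfTree ι (j + 1)) :
    branch i.1 x = of j (node i x) := by simp [branch, i.2]

theorem fin_two_eq_or (j k : Fin 2) : k = j ∨ k = j + 1 := by
  fin_cases j <;> fin_cases k <;> simp

theorem fin_two_ne_add_one (j : Fin 2) : j ≠ j + 1 := by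
  fin_cases j <;> simp

@[simp] theorem of_inj {j : Fin 2} {x y : HalfTree ι j} : of j x = of j y ↔ x = y := by
  refine ⟨fun h => ?_, congrArg _⟩
  have h2 : (⟨j, x⟩ : Σ j, HalfTree ι j) = ⟨j, y⟩ := h
  simpa using h2

theorem of_ne_of {j k : Fin 2} (h : j ≠ k) (x : HalfTree ι j) (y : HalfTree ι k) :
    of j x ≠ of k y := fun hc => h (congrArg Sigma.fst hc)

theorem base_ne_branch {j : Fin 2} (i : I j) (x : HalfTree ι (j + 1)) :
    base ι j ≠ branch i x := by
  by_cases h : i = ι j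
  · subst h
    rw [branch_base]
    exact of_ne_of (fin_two_ne_add_one j) _ _
  · rw [branch_punctured ⟨i, h⟩, base]
    simp

theorem branch_inj {j : Fin 2} {i i' : I j} {x x' : HalfTree ι (j + 1)} :
    branch i x = branch i' x' ↔ i = i' ∧ x = x' := by
  by_cases h : i = ι j <;> by_cases h' : i' = ι j
  · subst h h'
    simp
  · subst h
    rw [branch_punctured ⟨i', h'⟩, branch_base]
    refine ⟨fun hc => absurd hc (of_ne_of (fin_two_ne_add_one j).symm _ _), fun hc => ?_⟩
    exact absurd hc.1.symm h'
  · subst h'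
    rw [branch_punctured ⟨i, h⟩, branch_base]
    refine ⟨fun hc => absurd hc (of_ne_of (fin_two_ne_add_one j) _ _), fun hc => absurd hc.1 h⟩
  · rw [branch_punctured ⟨i, h⟩, branch_punctured ⟨i', h'⟩, of_inj, node_inj, Subtype.mk.injEq]

-- Seen from `base j`, the opposite half tree is just one more branch, with label `ι j`. This makes
-- all labels in `I j` equal and allows rotations that move `ι j`.
@[elab_as_elim]
theorem cases (j : Fin 2) {p : Vertex ι → Prop} (base : p (base ι j))
    (branch : ∀ i x, p (branch (j := j) i x)) (v : Vertex ι) : p v := by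
  obtain ⟨k, x, rfl⟩ : ∃ k x, v = of k x := ⟨v.1, v.2, rfl⟩
  rcases fin_two_eq_or j k with rfl | rfl
  · refine HalfTree.cases (p := fun x => p (of k x)) base (fun i x => ?_) x
    rw [← branch_punctured]
    exact branch _ _
  · have h := branch (ι j) x
    rwa [branch_base] at h

variable (ι) in
noncomputable def optionEquiv (j : Fin 2) : Option (I j × HalfTree ι (j + 1)) ≃ Vertex ι :=
  Equiv.ofBijective (fun o => o.elim (base ι j) fun p => branch p.1 p.2) (by
    constructor
    · rintro (_ | ⟨i, x⟩) (_ | ⟨i', x'⟩) h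
      · rfl
      · exact absurd h (base_ne_branch _ _)
      · exact absurd h.symm (base_ne_branch _ _)
      · obtain ⟨h1, h2⟩ := branch_inj.mp h
        exact congrArg some (Prod.ext h1 h2)
    · intro v
      induction v using cases j with
      | base => exact ⟨none, rfl⟩
      | branch i x => exact ⟨some (i, x), rfl⟩)

@[simp] theorem optionEquiv_none (j : Fin 2) : optionEquiv ι j none = base ι j := rfl

@[simp] theorem optionEquiv_some {j : Fin 2} (p : I j × HalfTree ι (j + 1)) :
    optionEquiv ι j (some p) = branch p.1 p.2 := rfl

@[simp] theorem optionEquiv_symm_base (j : Fin 2) : (optionEquiv ι j).symm (base ι j) = none :=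
  (Equiv.symm_apply_eq _).mpr rfl

@[simp] theorem optionEquiv_symm_branch {j : Fin 2} (i : I j) (x : HalfTree ι (j + 1)) :
    (optionEquiv ι j).symm (branch i x) = some (i, x) :=
  (Equiv.symm_apply_eq _).mpr rfl

end Vertex

open Vertex

theorem perm_vertex_ext (j : Fin 2) {p q : Equiv.Perm (Vertex ι)}
    (hbase : p (base ι j) = q (base ι j))
    (hbranch : ∀ (i : I j) x, p (branch i x) = q (branch i x)) : p = q :=
  Equiv.ext fun x => Vertex.cases j hbase hbranch x

variable (ι) in
/-- The rotation `σ` around the vertex `base j`. -/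
noncomputable def rotPerm (j : Fin 2) : Equiv.Perm (I j) →* Equiv.Perm (Vertex ι) :=
  MonoidHom.mk' (fun σ => (Vertex.optionEquiv ι j).permCongr
    (Equiv.optionCongr (Equiv.prodCongr σ (Equiv.refl _)))) (by
      intro σ τ
      apply perm_vertex_ext j <;> simp [Equiv.permCongr_apply])

@[simp] theorem rotPerm_base {j : Fin 2} (σ : Equiv.Perm (I j)) :
    rotPerm ι j σ (base ι j) = base ι j := by
  simp [rotPerm, Equiv.permCongr_apply]

@[simp] theorem rotPerm_branch {j : Fin 2} (σ : Equiv.Perm (I j)) (i : I j)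
    (x : HalfTree ι (j + 1)) : rotPerm ι j σ (branch i x) = branch (σ i) x := by
  simp [rotPerm, Equiv.permCongr_apply]

/-- A permutation that is supported in one of the half trees. -/
def sidePerm (j : Fin 2) : Equiv.Perm (HalfTree ι j) →* Equiv.Perm (Vertex ι) :=
  (Equiv.Perm.sigmaCongrRightHom (HalfTree ι)).comp
    (MonoidHom.mulSingle (fun j => Equiv.Perm (HalfTree ι j)) j)

@[simp] theorem sidePerm_self {j : Fin 2} (p : Equiv.Perm (HalfTree ι j)) (x : HalfTree ι j) :
    sidePerm j p (of j x) = of j (p x) := by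
  change of j ((Pi.mulSingle j p : ∀ j, Equiv.Perm (HalfTree ι j)) j x) = of j (p x)
  rw [Pi.mulSingle_eq_same]

theorem sidePerm_ne {j k : Fin 2} (h : k ≠ j) (p : Equiv.Perm (HalfTree ι j))
    (x : HalfTree ι k) : sidePerm j p (of k x) = of k x := by
  change of k ((Pi.mulSingle j p : ∀ j, Equiv.Perm (HalfTree ι j)) k x) = of k x
  rw [Pi.mulSingle_eq_of_ne h]
  rfl

theorem commute_sidePerm {j k : Fin 2} (h : k ≠ j) (p : Equiv.Perm (HalfTree ι j))
    (q : Equiv.Perm (HalfTree ι k)) : Commute (sidePerm j p) (sidePerm k q) :=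
  (Pi.mulSingle_commute (f := fun j => Equiv.Perm (HalfTree ι j)) h.symm p q).map
    (Equiv.Perm.sigmaCongrRightHom (HalfTree ι))

open Classical in
/-- A permutation that is supported in one branch at `base j`. -/
noncomputable def branchPerm {j : Fin 2} (i : I j) (p : Equiv.Perm (HalfTree ι (j + 1))) :
    Equiv.Perm (Vertex ι) :=
  (Vertex.optionEquiv ι j).permCongr (Equiv.optionCongr (Equiv.Perm.prodExtendRight i p))

@[simp] theorem branchPerm_base {j : Fin 2} (i : I j) (p : Equiv.Perm (HalfTree ι (j + 1))) :
    branchPerm i p (base ι j) = base ι j := by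
  simp [branchPerm, Equiv.permCongr_apply]

@[simp] theorem branchPerm_branch {j : Fin 2} (i : I j) (p : Equiv.Perm (HalfTree ι (j + 1)))
    (x : HalfTree ι (j + 1)) : branchPerm i p (branch i x) = branch i (p x) := by
  simp [branchPerm, Equiv.permCongr_apply]

open Classical in
theorem branchPerm_branch_ne {j : Fin 2} {i k : I j} (h : k ≠ i)
    (p : Equiv.Perm (HalfTree ι (j + 1))) (x : HalfTree ι (j + 1)) :
    branchPerm i p (branch k x) = branch k x := by
  simp [branchPerm, Equiv.permCongr_apply, Equiv.Perm.prodExtendRight_apply_ne (h := h)]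

/-- The common source of the three cases of (R6): which case occurs depends only on whether `σ i` is
the label `ι j` of the opposite half tree. -/
theorem rotPerm_conj_branchPerm {j : Fin 2} (σ : Equiv.Perm (I j)) (i : I j)
    (p : Equiv.Perm (HalfTree ι (j + 1))) :
    rotPerm ι j σ * branchPerm i p * (rotPerm ι j σ)⁻¹ = branchPerm (σ i) p := by
  rw [mul_inv_eq_iff_eq_mul]
  refine perm_vertex_ext j (by simp) fun l x => ?_
  by_cases h1 : l = i
  · subst h1
    simp
  · simp [branchPerm_branch_ne h1, branchPerm_branch_ne (fun h => h1 (σ.injective h))]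

theorem branchPerm_eq_sidePerm {j : Fin 2} (p : Equiv.Perm (HalfTree ι (j + 1))) :
    branchPerm (ι j) p = sidePerm (j + 1) p := by
  refine perm_vertex_ext j ?_ fun i x => ?_
  · rw [branchPerm_base, base, sidePerm_ne (fin_two_ne_add_one j)]
  · by_cases h : i = ι j
    · subst h
      rw [branchPerm_branch, branch_base, branch_base, sidePerm_self]
    · rw [branchPerm_branch_ne h, branch_punctured ⟨i, h⟩, sidePerm_ne (fin_two_ne_add_one j)]

theorem branchPerm_eq_sidePerm_nodePerm {j : Fin 2} (i : Punctured ι j)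
    (p : Equiv.Perm (HalfTree ι (j + 1))) :
    branchPerm i.1 p = sidePerm j (nodePerm i p) := by
  refine perm_vertex_ext j ?_ fun k x => ?_
  · rw [branchPerm_base, base, sidePerm_self, nodePerm_root]
  · by_cases h : k = i.1
    · subst h
      rw [branchPerm_branch, branch_punctured, branch_punctured, sidePerm_self, nodePerm_node]
    · rw [branchPerm_branch_ne h]
      by_cases hk : k = ι j
      · subst hk
        rw [branch_base, sidePerm_ne (fin_two_ne_add_one j).symm]
      · rw [branch_punctured ⟨k, hk⟩, sidePerm_self, nodePerm_node_ne]
        exact fun hc => h (congrArg Subtype.val hc)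

/-! ### The defining relations hold for permutations of the tree -/

variable (Γ : ∀ j, Subgroup (Equiv.Perm (I j)))

theorem stab_apply {j : Fin 2} (σ : stab ι Γ j) : (σ : Equiv.Perm (I j)) (ι j) = ι j :=
  σ.2.2

/-- The action of the stabilizer of `ι j` on the other points. -/
def stabPerm (j : Fin 2) : stab ι Γ j →* Equiv.Perm (Punctured ι j) :=
  MonoidHom.mk' (fun σ => (σ : Equiv.Perm (I j)).subtypePerm fun i => by
    rw [not_iff_not]
    conv_lhs => rw [← stab_apply Γ σ]
    exact σ.1.injective.eq_iff) fun σ τ => by ext; rfl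

@[simp] theorem coe_stabPerm {j : Fin 2} (σ : stab ι Γ j) (i : Punctured ι j) :
    (stabPerm Γ j σ i : I j) = (σ : Equiv.Perm (I j)) i := rfl

/-- A rotation that fixes the label `ι j` fixes the opposite half tree pointwise. This is why (R1)
holds on the tree. -/
theorem rotPerm_stab {j : Fin 2} (σ : stab ι Γ j) :
    rotPerm ι j σ = sidePerm j (rootPerm j (stabPerm Γ j σ)) := by
  refine perm_vertex_ext j ?_ fun k x => ?_
  · rw [rotPerm_base, base, sidePerm_self, rootPerm_root]
  by_cases hk : k = ι j
  · subst hk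
    rw [rotPerm_branch, stab_apply, branch_base, sidePerm_ne (fin_two_ne_add_one j).symm]
  · rw [rotPerm_branch, branch_punctured ⟨k, hk⟩, sidePerm_self, rootPerm_node,
      ← branch_punctured, coe_stabPerm]

/-- The permutation of the half tree given by rotation around the vertex `w`. -/
noncomputable def wordPerm : {j t : Fin 2} → Word ι j t → stab ι Γ t →* Equiv.Perm (HalfTree ι j)
  | _, _, .nil j => (rootPerm j).comp (stabPerm Γ j)
  | _, _, .cons i w => (nodePerm i).comp (wordPerm w)

theorem wordPerm_nil {j : Fin 2} (σ : stab ι Γ j) :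
    wordPerm Γ (.nil j) σ = rootPerm j (stabPerm Γ j σ) := rfl

theorem wordPerm_cons {j t : Fin 2} (i : Punctured ι j) (w : Word ι (j + 1) t) (σ : stab ι Γ t) :
    wordPerm Γ (.cons i w) σ = nodePerm i (wordPerm Γ w σ) := rfl

/-- Common first letters are stripped off until the words differ; then the supports lie in different
branches. -/
theorem commute_wordPerm {j t r : Fin 2} (v w : Word ι j t) (hl : v.length = w.length)
    (hne : v ≠ w) (x : Word ι t r) (σ : stab ι Γ t) (σ' : stab ι Γ r) :
    Commute (wordPerm Γ v σ) (wordPerm Γ (w.append x) σ') := by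
  induction v with
  | nil j =>
    cases w with
    | nil => exact absurd rfl hne
    | cons i w => simp [Word.length] at hl
  | cons s v ih =>
    generalize hu : Word.cons s v = u at hl hne
    cases w with
    | nil => subst hu; simp [Word.length] at hl
    | cons i w =>
      subst hu
      rw [Word.append, wordPerm_cons, wordPerm_cons]
      by_cases hs : i = s
      · subst hs
        refine (ih w (by simpa [Word.length] using hl) (fun h => hne (h ▸ rfl)) x σ).map _
      · exact commute_nodePerm hs _ _

/-- Each letter of `w` contributes the homomorphism `nodePerm`, which reduces the claim to a
rotation at the root. -/
theorem wordPerm_conj {j t r : Fin 2} (w : Word ι j t) (σ : stab ι Γ t) (k k' : Punctured ι t)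
    (hk : (σ : Equiv.Perm (I t)) k.1 = k'.1) (x : Word ι (t + 1) r) (σ' : stab ι Γ r) :
    wordPerm Γ w σ * wordPerm Γ (w.append (.cons k x)) σ' * (wordPerm Γ w σ)⁻¹ =
      wordPerm Γ (w.append (.cons k' x)) σ' := by
  induction w with
  | nil j =>
    have hk' : stabPerm Γ j σ k = k' := Subtype.ext hk
    simp only [Word.append, wordPerm_nil, wordPerm_cons, rootPerm_conj_nodePerm, hk']
  | cons i w ih =>
    simp only [Word.append, wordPerm_cons]
    rw [← map_inv, ← map_mul, ← map_mul, ih σ k k' hk x]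

variable (ι) in
/-- The action of the generators on the tree. -/
noncomputable def Gen.toPerm {A : ∀ j, Subgroup (Equiv.Perm (I j))} :
    Gen ι Γ A → Equiv.Perm (Vertex ι)
  | .g j σ => rotPerm ι j σ
  | .h j i w σ => sidePerm j (wordPerm Γ (.cons i w) σ)

theorem Gen.InQ.exists_toPerm_eq {A : ∀ j, Subgroup (Equiv.Perm (I j))} {j : Fin 2}
    {a : Gen ι Γ A} (ha : Gen.InQ ι Γ A j a) : ∃ p, Gen.toPerm ι Γ a = sidePerm j p := by
  cases ha with
  | g σ hσ => exact ⟨rootPerm j (stabPerm Γ j ⟨σ, hσ⟩), by rw [Gen.toPerm, ← rotPerm_stab]⟩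
  | h i w σ => exact ⟨wordPerm Γ (.cons i w) σ, rfl⟩

theorem Rel.lift_toPerm {A : ∀ j, Subgroup (Equiv.Perm (I j))} {a b : FreeGroup (Gen ι Γ A)}
    (hab : Rel ι Γ A a b) :
    FreeGroup.lift (Gen.toPerm ι Γ) a = FreeGroup.lift (Gen.toPerm ι Γ) b := by
  cases hab <;>
    simp only [map_mul, map_inv, map_one, gF, hF, FreeGroup.lift_apply_of]
  case r1 a b ha hb =>
    obtain ⟨p, hp⟩ := ha.exists_toPerm_eq
    obtain ⟨q, hq⟩ := hb.exists_toPerm_eq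
    rw [hp, hq]
    exact commute_sidePerm (by decide) p q
  case r2 j t r s i v w hl hne x σ σ' =>
    refine (commute_wordPerm Γ (.cons s v) (.cons i w) (by simpa [Word.length] using hl) ?_
      x σ σ').map _
    intro h
    cases h
    exact hne rfl
  case r3 j t r i w σ k k' hk x σ' =>
    simp only [Gen.toPerm]
    rw [← map_inv (sidePerm j), ← map_mul, ← map_mul]
    exact congrArg _ (wordPerm_conj Γ (.cons i w) σ k k' hk x σ')
  case r4_one j t i w => simp only [Gen.toPerm, map_one]
  case r4_mul j t i w σ' σ => simp only [Gen.toPerm, map_mul]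
  case r4_inv j t i w σ => simp only [Gen.toPerm, map_inv]
  case r5_one j => simp only [Gen.toPerm, Subgroup.coe_one, map_one]
  case r5_mul j σ σ' => simp only [Gen.toPerm, Subgroup.coe_mul, map_mul]
  case r5_inv j σ => simp only [Gen.toPerm, Subgroup.coe_inv, map_inv]
  case r6_nil j σ i hi σ' hσ' =>
    simp only [Gen.toPerm, wordPerm_cons]
    rw [← branchPerm_eq_sidePerm_nodePerm, rotPerm_conj_branchPerm, hi, branchPerm_eq_sidePerm,
      wordPerm_nil, ← rotPerm_stab]
  case r6_cons j t σ i hi k x σ' =>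
    simp only [Gen.toPerm]
    rw [wordPerm_cons, ← branchPerm_eq_sidePerm_nodePerm, rotPerm_conj_branchPerm, hi,
      branchPerm_eq_sidePerm]
  case r6_ne j t σ i i' hi w σ' =>
    simp only [Gen.toPerm, wordPerm_cons]
    rw [← branchPerm_eq_sidePerm_nodePerm, rotPerm_conj_branchPerm, hi,
      branchPerm_eq_sidePerm_nodePerm]

variable (ι) in
/-- The action on the tree of a group given by the generators and relations. -/
noncomputable def Grp.toPerm (A : ∀ j, Subgroup (Equiv.Perm (I j))) :
    Grp ι Γ A →* Equiv.Perm (Vertex ι) :=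
  PresentedGroup.toGroup (rels := rels ι Γ A) (f := Gen.toPerm ι Γ) (by
    rintro r ⟨a, b, hab, rfl⟩
    rw [map_mul, map_inv, hab.lift_toPerm, mul_inv_cancel])

end Amalgam

namespace Amalgam

variable {I : Fin 2 → Type u} {ι : ∀ j, I j}

open HalfTree Vertex

/-! ### Edges of the tree -/

/-- `Link l x y` says that `y` is the neighbour of `x` along the edge that has the label `l`
at `x`. The edge from a vertex of type `t` towards the root has the label `ι t`. -/
inductive HalfTree.Link : ∀ {j : Fin 2}, (Σ t, I t) → HalfTree ι j → HalfTree ι j → Prop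
  | down {j : Fin 2} (i : Punctured ι j) : Link ⟨j, i.1⟩ (root j) (node i (root (j + 1)))
  | up {j : Fin 2} (i : Punctured ι j) :
      Link ⟨j + 1, ι (j + 1)⟩ (node i (root (j + 1))) (root j)
  | child {j : Fin 2} {l : Σ t, I t} (i : Punctured ι j) {x y : HalfTree ι (j + 1)} :
      Link l x y → Link l (node i x) (node i y)

namespace HalfTree

theorem link_iff {j : Fin 2} {l : Σ t, I t} {x y : HalfTree ι j} :
    Link l x y ↔ (∃ i : Punctured ι j, l = ⟨j, i.1⟩ ∧ x = root j ∧ y = node i (root (j + 1))) ∨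
      (∃ i : Punctured ι j, l = ⟨j + 1, ι (j + 1)⟩ ∧ x = node i (root (j + 1)) ∧ y = root j) ∨
      ∃ (i : Punctured ι j) (x' y' : HalfTree ι (j + 1)), Link l x' y' ∧ x = node i x' ∧
        y = node i y' := by
  constructor
  · rintro (i | i | ⟨i, h⟩)
    · exact Or.inl ⟨i, rfl, rfl, rfl⟩
    · exact Or.inr (Or.inl ⟨i, rfl, rfl, rfl⟩)
    · exact Or.inr (Or.inr ⟨i, _, _, h, rfl, rfl⟩)
  · rintro (⟨i, rfl, rfl, rfl⟩ | ⟨i, rfl, rfl, rfl⟩ | ⟨i, x', y', h, rfl, rfl⟩)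
    · exact .down i
    · exact .up i
    · exact .child i h

theorem Link.label_of_root {j : Fin 2} {l : Σ t, I t} {y : HalfTree ι j}
    (h : Link l (root j) y) : ∃ i : Punctured ι j, l = ⟨j, i.1⟩ ∧ y = node i (root (j + 1)) := by
  rcases link_iff.mp h with ⟨i, hl, _, hy⟩ | ⟨i, _, hx, _⟩ | ⟨i, x', y', _, hx, _⟩
  · exact ⟨i, hl, hy⟩
  · exact absurd hx (root_ne_node _ _)
  · exact absurd hx (root_ne_node _ _)

/-- At the root, the label `ι j` is reserved for the edge to the other half tree or, inside a larger
half tree, to the parent. -/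
theorem not_link_root {j : Fin 2} {y : HalfTree ι j} : ¬ Link ⟨j, ι j⟩ (root j) y := by
  intro h
  obtain ⟨i, hl, _⟩ := h.label_of_root
  rw [Sigma.mk.injEq, heq_eq_eq] at hl
  exact i.2 hl.2.symm

/-- The only possible clash is between the edge to the parent and an edge to a child, which
`not_link_root` excludes. -/
theorem Link.unique {j : Fin 2} {l : Σ t, I t} {x y y' : HalfTree ι j} (h : Link l x y)
    (h' : Link l x y') : y = y' := by
  induction x using HalfTree.induction with
  | root j =>
    obtain ⟨i, rfl, rfl⟩ := h.label_of_root
    obtain ⟨i', hl, rfl⟩ := h'.label_of_root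
    rw [Sigma.mk.injEq, heq_eq_eq] at hl
    rw [Subtype.ext hl.2]
  | node i x ih =>
    rcases link_iff.mp h with ⟨k, _, hx, _⟩ | ⟨k, hl, hx, rfl⟩ | ⟨k, x₁, y₁, h₁, hx, rfl⟩ <;>
      rcases link_iff.mp h' with ⟨k', _, hx', _⟩ | ⟨k', hl', hx', rfl⟩ |
        ⟨k', x₂, y₂, h₂, hx', rfl⟩ <;>
      simp only [node_inj, node_ne_root] at hx hx'
    · rfl
    · rw [← hx'.2, hx.2, hl] at h₂
      exact absurd h₂ not_link_root
    · rw [← hx.2, hx'.2, hl'] at h₁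
      exact absurd h₁ not_link_root
    · obtain ⟨rfl, rfl⟩ := hx
      obtain ⟨rfl, rfl⟩ := hx'
      rw [ih h₁ h₂]

theorem Link.symm {j : Fin 2} {l : Σ t, I t} {x y : HalfTree ι j} (h : Link l x y) :
    ∃ l' : Σ t, I t, Link l' y x := by
  induction h with
  | down i => exact ⟨_, .up i⟩
  | up i => exact ⟨_, .down i⟩
  | child i _ ih => exact ih.imp fun _ h => .child i h

theorem Link.ne {j : Fin 2} {l : Σ t, I t} {x y : HalfTree ι j} (h : Link l x y) : x ≠ y := by
  induction h with
  | down i => exact root_ne_node _ _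
  | up i => exact node_ne_root _ _
  | child i _ ih => exact fun h => ih (node_inj.mp h).2

theorem reflTransGen_link {j : Fin 2} (x : HalfTree ι j) :
    Relation.ReflTransGen (fun x y => ∃ l : Σ t, I t, Link l x y) (root j) x := by
  induction x using HalfTree.induction with
  | root j => exact .refl
  | node i x ih => exact .head ⟨_, .down i⟩ (ih.lift (HalfTree.node i) fun _ _ h => h.imp fun _ h => .child i h)

end HalfTree

namespace Vertex

/-- `Link l v w` says that `w` is the neighbour of `v` along the edge that has the label `l`
at `v`. -/
def Link (l : Σ t, I t) (v w : Vertex ι) : Prop :=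
  (∃ j, l = ⟨j, ι j⟩ ∧ v = base ι j ∧ w = base ι (j + 1)) ∨
    ∃ (j : Fin 2) (x y : HalfTree ι j), HalfTree.Link l x y ∧ v = of j x ∧ w = of j y

theorem add_one_add_one (j : Fin 2) : j + 1 + 1 = j := by
  fin_cases j <;> rfl

/-- The edges of the tree as seen from `base j`. -/
theorem link_iff (j : Fin 2) {l : Σ t, I t} {v w : Vertex ι} :
    Link l v w ↔ (∃ i : I j, l = ⟨j, i⟩ ∧ v = base ι j ∧ w = branch i (root (j + 1))) ∨
      (∃ i : I j, l = ⟨j + 1, ι (j + 1)⟩ ∧ v = branch i (root (j + 1)) ∧ w = base ι j) ∨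
      ∃ (i : I j) (x y : HalfTree ι (j + 1)), HalfTree.Link l x y ∧ v = branch i x ∧
        w = branch i y := by
  constructor
  · rintro (⟨k, rfl, rfl, rfl⟩ | ⟨k, x, y, h, rfl, rfl⟩)
    · rcases fin_two_eq_or j k with rfl | rfl
      · exact Or.inl ⟨ι k, rfl, rfl, (branch_base _).symm⟩
      · refine Or.inr (Or.inl ⟨ι j, rfl, (branch_base _).symm, ?_⟩)
        rw [add_one_add_one]
    · rcases fin_two_eq_or j k with rfl | rfl
      · rcases HalfTree.link_iff.mp h with ⟨i, rfl, rfl, rfl⟩ | ⟨i, rfl, rfl, rfl⟩ |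
          ⟨i, x', y', h', rfl, rfl⟩
        · exact Or.inl ⟨i.1, rfl, rfl, (branch_punctured _ _).symm⟩
        · exact Or.inr (Or.inl ⟨i.1, rfl, (branch_punctured _ _).symm, rfl⟩)
        · exact Or.inr (Or.inr ⟨i.1, x', y', h', (branch_punctured _ _).symm,
            (branch_punctured _ _).symm⟩)
      · exact Or.inr (Or.inr ⟨ι j, x, y, h, (branch_base _).symm, (branch_base _).symm⟩)
  · rintro (⟨i, rfl, rfl, rfl⟩ | ⟨i, rfl, rfl, rfl⟩ | ⟨i, x, y, h, rfl, rfl⟩) <;>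
      by_cases hi : i = ι j
    · subst hi
      exact Or.inl ⟨j, rfl, rfl, branch_base _⟩
    · exact Or.inr ⟨j, _, _, .down ⟨i, hi⟩, rfl, branch_punctured ⟨i, hi⟩ _⟩
    · subst hi
      refine Or.inl ⟨j + 1, rfl, branch_base _, ?_⟩
      rw [add_one_add_one]
    · exact Or.inr ⟨j, _, _, .up ⟨i, hi⟩, branch_punctured ⟨i, hi⟩ _, rfl⟩
    · subst hi
      exact Or.inr ⟨j + 1, x, y, h, branch_base _, branch_base _⟩
    · exact Or.inr ⟨j, _, _, .child ⟨i, hi⟩ h, branch_punctured ⟨i, hi⟩ _,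
        branch_punctured ⟨i, hi⟩ _⟩

theorem Link.unique {l : Σ t, I t} {v w w' : Vertex ι} (h : Link l v w) (h' : Link l v w') :
    w = w' := by
  rcases (link_iff 0).mp h with ⟨k, hl, hv, rfl⟩ | ⟨k, hl, hv, rfl⟩ | ⟨k, x₁, y₁, h₁, hv, rfl⟩ <;>
    rcases (link_iff 0).mp h' with ⟨k', hl', hv', rfl⟩ | ⟨k', hl', hv', rfl⟩ |
      ⟨k', x₂, y₂, h₂, hv', rfl⟩
  · rw [hl, Sigma.mk.injEq, heq_eq_eq] at hl'
    rw [hl'.2]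
  · exact absurd (hv.symm.trans hv') (base_ne_branch _ _)
  · exact absurd (hv.symm.trans hv') (base_ne_branch _ _)
  · exact absurd (hv'.symm.trans hv) (base_ne_branch _ _)
  · rfl
  · rw [← (branch_inj.mp (hv.symm.trans hv')).2, hl] at h₂
    exact absurd h₂ not_link_root
  · exact absurd (hv'.symm.trans hv) (base_ne_branch _ _)
  · rw [← (branch_inj.mp (hv'.symm.trans hv)).2, hl'] at h₁
    exact absurd h₁ not_link_root
  · obtain ⟨rfl, rfl⟩ := branch_inj.mp (hv.symm.trans hv')
    rw [h₁.unique h₂]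

theorem Link.symm {l : Σ t, I t} {v w : Vertex ι} (h : Link l v w) :
    ∃ l' : Σ t, I t, Link l' w v := by
  rcases h with ⟨j, rfl, rfl, rfl⟩ | ⟨j, x, y, h, rfl, rfl⟩
  · exact ⟨_, Or.inl ⟨j + 1, rfl, rfl, by rw [add_one_add_one]⟩⟩
  · obtain ⟨l', h'⟩ := h.symm
    exact ⟨l', Or.inr ⟨j, y, x, h', rfl, rfl⟩⟩

theorem Link.ne {l : Σ t, I t} {v w : Vertex ι} (h : Link l v w) : v ≠ w := by
  rcases h with ⟨j, rfl, rfl, rfl⟩ | ⟨j, x, y, h, rfl, rfl⟩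
  · exact of_ne_of (fin_two_ne_add_one j) _ _
  · rw [Ne, of_inj]
    exact h.ne

end Vertex

variable (ι) in
/-- The tree. -/
def tree : SimpleGraph (Vertex ι) where
  Adj v w := ∃ l : Σ t, I t, Vertex.Link l v w
  symm := ⟨fun _ _ ⟨_, h⟩ => h.symm⟩
  loopless := ⟨fun _ ⟨_, h⟩ => h.ne rfl⟩

theorem tree_adj_base (j : Fin 2) : (tree ι).Adj (base ι j) (base ι (j + 1)) :=
  ⟨_, Or.inl ⟨j, rfl, rfl, rfl⟩⟩

theorem reachable_base_of (j : Fin 2) (x : HalfTree ι j) :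
    (tree ι).Reachable (base ι j) (of j x) := by
  rw [SimpleGraph.reachable_iff_reflTransGen]
  exact (reflTransGen_link x).lift (of j) fun _ _ ⟨l, h⟩ => ⟨l, Or.inr ⟨j, _, _, h, rfl, rfl⟩⟩

theorem tree_connected : (tree ι).Connected := by
  have key : ∀ v, (tree ι).Reachable (base ι 0) v := by
    rintro ⟨j, x⟩
    rcases fin_two_eq_or 0 j with rfl | rfl
    · exact reachable_base_of _ x
    · exact (tree_adj_base 0).reachable.trans (reachable_base_of _ x)
  have : Nonempty (Vertex ι) := ⟨base ι 0⟩
  exact ⟨fun v w => (key v).symm.trans (key w)⟩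

variable (ι) in
/-- The vertices of a half tree. -/
def side (j : Fin 2) : Set (Vertex ι) := Set.range (of j)

theorem compl_side_add_one (j : Fin 2) : (side ι (j + 1))ᶜ = side ι j := by
  ext ⟨k, x⟩
  change of k x ∈ _ ↔ of k x ∈ _
  rcases fin_two_eq_or j k with rfl | rfl
  · refine iff_of_true ?_ ⟨x, rfl⟩
    rintro ⟨y, hy⟩
    exact of_ne_of (fin_two_ne_add_one k).symm _ _ hy
  · refine iff_of_false (fun h => h ⟨x, rfl⟩) ?_
    rintro ⟨y, hy⟩
    exact of_ne_of (fin_two_ne_add_one j) _ _ hy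

/-- All edges but the one between the two bases stay within a half tree. -/
theorem eq_base_of_adj {j : Fin 2} {v w : Vertex ι} (hv : v ∈ side ι (j + 1))
    (hw : w ∉ side ι (j + 1)) (h : (tree ι).Adj v w) : v = base ι (j + 1) ∧ w = base ι j := by
  obtain ⟨l, ⟨k, rfl, rfl, rfl⟩ | ⟨k, x, y, h, rfl, rfl⟩⟩ := h
  · rcases fin_two_eq_or j k with rfl | rfl
    · exact absurd ⟨_, rfl⟩ hw
    · exact ⟨rfl, by rw [add_one_add_one]⟩
  · obtain ⟨z, hz⟩ := hv
    have hk : j + 1 = k := by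
      by_contra hc
      exact of_ne_of hc _ _ hz
    subst hk
    exact absurd ⟨y, rfl⟩ hw

/-! ### Rotations, labels and singular vertices -/

/-- Branches are moved rigidly, and in each of them the edge back to `base j` has the same label `ι
(j + 1)` at its far end. So labels can change only at `base j`. -/
theorem link_rotPerm {j : Fin 2} (σ : Equiv.Perm (I j)) {l : Σ t, I t} {v w : Vertex ι}
    (hv : v ≠ base ι j) (h : Vertex.Link l v w) :
    Vertex.Link l (rotPerm ι j σ v) (rotPerm ι j σ w) := by
  rw [Vertex.link_iff j] at h ⊢
  rcases h with ⟨i, rfl, rfl, rfl⟩ | ⟨i, rfl, rfl, rfl⟩ | ⟨i, x, y, h, rfl, rfl⟩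
  · exact absurd rfl hv
  · exact Or.inr (Or.inl ⟨σ i, rfl, by simp, by simp⟩)
  · exact Or.inr (Or.inr ⟨σ i, x, y, h, by simp, by simp⟩)

theorem adj_rotPerm {j : Fin 2} (σ : Equiv.Perm (I j)) {v w : Vertex ι}
    (h : (tree ι).Adj v w) : (tree ι).Adj (rotPerm ι j σ v) (rotPerm ι j σ w) := by
  obtain ⟨l, h⟩ := h
  by_cases hv : v = base ι j
  · subst hv
    rcases (Vertex.link_iff j).mp h with ⟨i, rfl, _, rfl⟩ | ⟨i, _, hv, _⟩ | ⟨i, x, y, _, hv, _⟩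
    · exact ⟨⟨j, σ i⟩, (Vertex.link_iff j).mpr (Or.inl ⟨σ i, rfl, by simp, by simp⟩)⟩
    · exact absurd hv (base_ne_branch _ _)
    · exact absurd hv (base_ne_branch _ _)
  · exact ⟨l, link_rotPerm σ hv h⟩

variable (ι) in
/-- The vertices at which a permutation does not preserve the labels of the edges. -/
def singularSet (p : Equiv.Perm (Vertex ι)) : Set (Vertex ι) :=
  {v | ∃ (l : Σ t, I t) (w : Vertex ι), Vertex.Link l v w ∧ ¬ Vertex.Link l (p v) (p w)}

theorem singularSet_one : singularSet ι 1 = ∅ := by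
  simp [singularSet]

theorem singularSet_rotPerm {j : Fin 2} (σ : Equiv.Perm (I j)) :
    singularSet ι (rotPerm ι j σ) ⊆ {base ι j} := by
  rintro v ⟨l, w, h, hn⟩
  by_contra hv
  exact hn (link_rotPerm σ hv h)

theorem singularSet_mul (p q : Equiv.Perm (Vertex ι)) :
    singularSet ι (p * q) ⊆ q ⁻¹' singularSet ι p ∪ singularSet ι q := by
  rintro v ⟨l, w, h, hn⟩
  by_cases hq : Vertex.Link l (q v) (q w)
  · exact Or.inl ⟨l, q w, hq, hn⟩
  · exact Or.inr ⟨l, w, h, hq⟩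

/-- If the label at the fixed vertex `v` were preserved, then `w` and its image would be neighbours
of `v` with the same label. This makes fixed boundaries finite. -/
theorem mem_singularSet {p : Equiv.Perm (Vertex ι)} {v w : Vertex ι} (hv : p v = v)
    (hadj : (tree ι).Adj v w) (hw : p w ≠ w) : v ∈ singularSet ι p := by
  obtain ⟨l, h⟩ := hadj
  refine ⟨l, w, h, fun hc => hw ?_⟩
  rw [hv] at hc
  exact hc.unique h

/-- The type of a vertex. -/
def Vertex.type (v : Vertex ι) : Fin 2 := v.2.1

@[simp] theorem type_base (j : Fin 2) : (base ι j).type = j := rfl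

theorem type_branch {j : Fin 2} (i : I j) (x : HalfTree ι (j + 1)) :
    (branch i x).type = x.1 := by
  unfold branch
  split <;> rfl

/-- The two bases have different types, so invariance of types rules out inversions of the base
edge. -/
theorem type_rotPerm {j : Fin 2} (σ : Equiv.Perm (I j)) (v : Vertex ι) :
    (rotPerm ι j σ v).type = v.type := by
  induction v using Vertex.cases j with
  | base => simp
  | branch i x => simp [type_branch]

/-! ### Groups generated by rotations -/

variable {Γ : ∀ j, Subgroup (Equiv.Perm (I j))}

variable (ι Γ) in
theorem stab_le (j : Fin 2) : stab ι Γ j ≤ Γ j := inf_le_left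

variable (ι Γ) in
/-- The part of the structure of the amalgam that determines its action on the tree. -/
structure RotationSystem (G : Type*) [Group G] where
  rot : ∀ j, Γ j →* G
  word : ∀ {j t : Fin 2}, Word ι j t → stab ι Γ t → G
  toPerm : G →* Equiv.Perm (Vertex ι)
  closure_rot : Subgroup.closure {g | ∃ (j : Fin 2) (σ : Γ j), rot j σ = g} = ⊤
  word_nil (j : Fin 2) (σ : stab ι Γ j) :
    word (.nil j) σ = rot j (Subgroup.inclusion (stab_le ι Γ j) σ)
  commute_word {j k t r : Fin 2} (hjk : j ≠ k) (v : Word ι j t) (w : Word ι k r)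
    (σ : stab ι Γ t) (τ : stab ι Γ r) : Commute (word v σ) (word w τ)
  conj_base {j t : Fin 2} (σ : Γ j) (i : Punctured ι j) (hi : (σ : Equiv.Perm (I j)) i.1 = ι j)
    (w : Word ι (j + 1) t) (τ : stab ι Γ t) :
    rot j σ * word (.cons i w) τ * (rot j σ)⁻¹ = word w τ
  conj_ne {j t : Fin 2} (σ : Γ j) (i i' : Punctured ι j)
    (hi : (σ : Equiv.Perm (I j)) i.1 = i'.1) (w : Word ι (j + 1) t) (τ : stab ι Γ t) :
    rot j σ * word (.cons i w) τ * (rot j σ)⁻¹ = word (.cons i' w) τ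
  toPerm_rot (j : Fin 2) (σ : Γ j) : toPerm (rot j σ) = rotPerm ι j σ

namespace RotationSystem

variable {G : Type*} [Group G] (S : RotationSystem ι Γ G)

@[elab_as_elim]
theorem induction {p : G → Prop} (one : p 1) (mul : ∀ j σ g, p g → p (S.rot j σ * g)) (g : G) :
    p g := by
  have hg : g ∈ Subgroup.closure {g | ∃ (j : Fin 2) (σ : Γ j), S.rot j σ = g} := by
    rw [S.closure_rot]
    trivial
  induction hg using Subgroup.closure_induction_left with
  | one => exact one
  | mul_left x hx y _ hy =>
    obtain ⟨j, σ, rfl⟩ := hx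
    exact mul j σ y hy
  | inv_mul_cancel x hx y _ hy =>
    obtain ⟨j, σ, rfl⟩ := hx
    rw [← map_inv]
    exact mul j σ⁻¹ y hy

theorem finite_singularSet (g : G) : (singularSet ι (S.toPerm g)).Finite := by
  induction g using S.induction with
  | one => simp [singularSet_one]
  | mul j σ g hg =>
    rw [map_mul, S.toPerm_rot]
    refine Set.Finite.subset (Set.Finite.union ?_ hg) (singularSet_mul _ _)
    exact ((Set.finite_singleton _).subset (singularSet_rotPerm _)).preimage
      (S.toPerm g).injective.injOn

theorem adj_toPerm (g : G) {v w : Vertex ι} (h : (tree ι).Adj v w) :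
    (tree ι).Adj (S.toPerm g v) (S.toPerm g w) := by
  induction g using S.induction with
  | one => simpa using h
  | mul j σ g hg =>
    rw [map_mul, S.toPerm_rot]
    exact adj_rotPerm _ hg

theorem type_toPerm (g : G) (v : Vertex ι) : (S.toPerm g v).type = v.type := by
  induction g using S.induction with
  | one => simp
  | mul j σ g hg =>
    rw [map_mul, S.toPerm_rot]
    exact (type_rotPerm _ _).trans hg

end RotationSystem

end Amalgam

/-! ### Subgroups generated by commuting sets -/

theorem Subgroup.commute_of_mem_closure {G : Type*} [Group G] {s t : Set G}
    (hc : ∀ a ∈ s, ∀ b ∈ t, Commute a b) {a b : G} (ha : a ∈ Subgroup.closure s)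
    (hb : b ∈ Subgroup.closure t) : Commute a b := by
  induction ha using Subgroup.closure_induction with
  | mem a ha =>
    induction hb using Subgroup.closure_induction with
    | mem b hb => exact hc a ha b hb
    | one => exact Commute.one_right a
    | mul _ _ _ _ h h' => exact h.mul_right h'
    | inv _ _ h => exact h.inv_right
  | one => exact Commute.one_left b
  | mul _ _ _ _ h h' => exact h.mul_left h'
  | inv _ _ h => exact h.inv_left

theorem Subgroup.exists_mul_of_mem_closure_union {G : Type*} [Group G] {s t : Set G}
    (hc : ∀ a ∈ s, ∀ b ∈ t, Commute a b) {g : G} (hg : g ∈ Subgroup.closure (s ∪ t)) :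
    ∃ a ∈ Subgroup.closure s, ∃ b ∈ Subgroup.closure t, g = a * b := by
  induction hg using Subgroup.closure_induction with
  | mem g hg =>
    rcases hg with hg | hg
    · exact ⟨g, Subgroup.subset_closure hg, 1, one_mem _, (mul_one g).symm⟩
    · exact ⟨1, one_mem _, g, Subgroup.subset_closure hg, (one_mul g).symm⟩
  | one => exact ⟨1, one_mem _, 1, one_mem _, (one_mul 1).symm⟩
  | mul _ _ _ _ h h' =>
    obtain ⟨a, ha, b, hb, rfl⟩ := h
    obtain ⟨a', ha', b', hb', rfl⟩ := h'
    refine ⟨a * a', mul_mem ha ha', b * b', mul_mem hb hb', ?_⟩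
    rw [mul_assoc, ← mul_assoc b, ← (Subgroup.commute_of_mem_closure hc ha' hb).eq]
    group
  | inv _ _ h =>
    obtain ⟨a, ha, b, hb, rfl⟩ := h
    refine ⟨a⁻¹, inv_mem ha, b⁻¹, inv_mem hb, ?_⟩
    rw [(Subgroup.commute_of_mem_closure hc ha hb).eq, mul_inv_rev]

/-! ### Faithfulness of the action -/

namespace Amalgam

variable {I : Fin 2 → Type u} {ι : ∀ j, I j}

open HalfTree Vertex

theorem of_root_ne_of_node {j k : Fin 2} (i : Punctured ι j) (x : HalfTree ι (j + 1)) :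
    of k (root k) ≠ of j (HalfTree.node i x) := by
  by_cases h : k = j
  · subst h
    rw [Ne, of_inj]
    exact root_ne_node _ _
  · exact of_ne_of h _ _

variable {Γ : ∀ j, Subgroup (Equiv.Perm (I j))}

theorem wordPerm_root {j t : Fin 2} (w : Word ι j t) (σ : stab ι Γ t) :
    wordPerm Γ w σ (root j) = root j := by
  cases w with
  | nil => rw [wordPerm_nil, rootPerm_root]
  | cons i w => rw [wordPerm_cons, nodePerm_root]

namespace RotationSystem

variable {G : Type*} [Group G] (S : RotationSystem ι Γ G)

theorem exists_rot (htrans : ∀ j, MulAction.IsPretransitive (Γ j) (I j)) {j : Fin 2}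
    (i k : I j) : ∃ σ : Γ j, (σ : Equiv.Perm (I j)) i = k :=
  (htrans j).exists_smul_eq i k

/-- By transitivity some rotation takes the first letter to `ι j`; conjugation by it removes that
letter, both in the group and on the tree. -/
theorem toPerm_word (htrans : ∀ j, MulAction.IsPretransitive (Γ j) (I j)) {j t : Fin 2}
    (w : Word ι j t) (σ : stab ι Γ t) : S.toPerm (S.word w σ) = sidePerm j (wordPerm Γ w σ) := by
  induction w with
  | nil j => rw [S.word_nil, S.toPerm_rot, wordPerm_nil, ← rotPerm_stab]; rfl
  | @cons j t i w ih =>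
    obtain ⟨ρ, hρ⟩ := exists_rot htrans i.1 (ι j)
    have h := congrArg S.toPerm (S.conj_base ρ i hρ w σ)
    rw [ih, map_mul, map_mul, map_inv, S.toPerm_rot, mul_inv_eq_iff_eq_mul,
      ← branchPerm_eq_sidePerm, ← hρ, ← rotPerm_conj_branchPerm, inv_mul_cancel_right] at h
    rw [mul_left_cancel h, branchPerm_eq_sidePerm_nodePerm, wordPerm_cons]

/-! ### The edge group -/

/-- The elements `word w σ` for words that start at index `j` and have length less than `n`. -/
def wordSet (j : Fin 2) (n : ℕ) : Set G :=
  {g | ∃ (t : Fin 2) (w : Word ι j t) (σ : stab ι Γ t), w.length < n ∧ g = S.word w σ}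

/-- The elements `word (cons i w) σ` for words `w` of length less than `n` and `i ∈ F`. -/
def branchSet {j : Fin 2} (F : Set (Punctured ι j)) (n : ℕ) : Set G :=
  {g | ∃ i ∈ F, ∃ (t : Fin 2) (w : Word ι (j + 1) t) (σ : stab ι Γ t), w.length < n ∧
    g = S.word (.cons i w) σ}

theorem branchSet_mono {j : Fin 2} {F F' : Set (Punctured ι j)} (h : F ⊆ F') (n : ℕ) :
    S.branchSet F n ⊆ S.branchSet F' n := by
  rintro _ ⟨i, hi, t, w, σ, hw, rfl⟩
  exact ⟨i, h hi, t, w, σ, hw, rfl⟩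

/-- Rotate the branch `i` onto the opposite half tree. The branch `k` stays on its side, and
elements of opposite sides commute. -/
theorem commute_branchSet (htrans : ∀ j, MulAction.IsPretransitive (Γ j) (I j)) {j : Fin 2}
    {F F' : Set (Punctured ι j)} (hF : Disjoint F F') {n : ℕ} {a b : G}
    (ha : a ∈ S.branchSet F n) (hb : b ∈ S.branchSet F' n) : Commute a b := by
  obtain ⟨i, hi, t, w, σ, -, rfl⟩ := ha
  obtain ⟨k, hk, r, v, τ, -, rfl⟩ := hb
  obtain ⟨ρ, hρ⟩ := exists_rot htrans i.1 (ι j)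
  have hne : (ρ : Equiv.Perm (I j)) k.1 ≠ ι j := fun hc =>
    hF.ne_of_mem hi hk (Subtype.ext (ρ.1.injective (hρ.trans hc.symm)))
  rw [← Commute.conj_iff (S.rot j ρ), S.conj_base ρ i hρ, S.conj_ne ρ k ⟨_, hne⟩ rfl]
  exact S.commute_word (fin_two_ne_add_one j).symm _ _ _ _

theorem conj_mem_closure_wordSet {j : Fin 2} {i : Punctured ι j} {ρ : Γ j}
    (hρ : (ρ : Equiv.Perm (I j)) i.1 = ι j) {n : ℕ} {a : G}
    (ha : a ∈ Subgroup.closure (S.branchSet {i} n)) :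
    S.rot j ρ * a * (S.rot j ρ)⁻¹ ∈ Subgroup.closure (S.wordSet (j + 1) n) := by
  have hle : Subgroup.closure (S.branchSet {i} n) ≤
      (Subgroup.closure (S.wordSet (j + 1) n)).comap (MulAut.conj (S.rot j ρ)).toMonoidHom := by
    rw [Subgroup.closure_le]
    rintro _ ⟨_, rfl, t, w, σ, hw, rfl⟩
    refine Subgroup.subset_closure ⟨t, w, σ, hw, ?_⟩
    exact S.conj_base ρ _ hρ w σ
  exact hle ha

theorem exists_toPerm_eq_nodePerm (htrans : ∀ j, MulAction.IsPretransitive (Γ j) (I j))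
    {j : Fin 2} {i : Punctured ι j} {n : ℕ} {a : G}
    (ha : a ∈ Subgroup.closure (S.branchSet {i} n)) :
    ∃ p, S.toPerm a = sidePerm j (nodePerm i p) := by
  have hle : Subgroup.closure (S.branchSet {i} n) ≤
      ((sidePerm j).comp (nodePerm i)).range.comap S.toPerm := by
    rw [Subgroup.closure_le]
    rintro _ ⟨_, rfl, t, w, σ, hw, rfl⟩
    exact ⟨wordPerm Γ w σ, by rw [S.toPerm_word htrans, wordPerm_cons]; rfl⟩
  obtain ⟨p, hp⟩ := hle ha
  exact ⟨p, hp.symm⟩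

theorem exists_toPerm_eq_sidePerm (htrans : ∀ j, MulAction.IsPretransitive (Γ j) (I j))
    {j : Fin 2} {n : ℕ} {a : G} (ha : a ∈ Subgroup.closure (S.wordSet j n)) :
    ∃ p, S.toPerm a = sidePerm j p := by
  have hle : Subgroup.closure (S.wordSet j n) ≤ (sidePerm j).range.comap S.toPerm := by
    rw [Subgroup.closure_le]
    rintro _ ⟨t, w, σ, hw, rfl⟩
    exact ⟨wordPerm Γ w σ, (S.toPerm_word htrans _ _).symm⟩
  obtain ⟨p, hp⟩ := hle ha
  exact ⟨p, hp.symm⟩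

theorem toPerm_branch_of_notMem (htrans : ∀ j, MulAction.IsPretransitive (Γ j) (I j))
    {j : Fin 2} {F : Set (Punctured ι j)} {i : Punctured ι j} (hi : i ∉ F) {n : ℕ} {a : G}
    (ha : a ∈ Subgroup.closure (S.branchSet F n)) (x : HalfTree ι (j + 1)) :
    S.toPerm a (of j (HalfTree.node i x)) = of j (HalfTree.node i x) := by
  induction ha using Subgroup.closure_induction with
  | mem a ha =>
    obtain ⟨k, hk, t, w, σ, -, rfl⟩ := ha
    rw [S.toPerm_word htrans, sidePerm_self, wordPerm_cons, nodePerm_node_ne]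
    exact fun hc => hi (hc ▸ hk)
  | one => simp
  | mul a b _ _ h h' => rw [map_mul, Equiv.Perm.mul_apply, h', h]
  | inv a _ h => rw [map_inv, Equiv.Perm.inv_eq_iff_eq, h]

/-- Elements supported in branches fix the neighbours of the root, so these neighbours detect the
rotation around the root. -/
theorem toPerm_branch_root (htrans : ∀ j, MulAction.IsPretransitive (Γ j) (I j))
    {j : Fin 2} {F : Set (Punctured ι j)} {n : ℕ} {a : G}
    (ha : a ∈ Subgroup.closure (S.branchSet F n)) (i : Punctured ι j) :
    S.toPerm a (of j (HalfTree.node i (root (j + 1)))) =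
      of j (HalfTree.node i (root (j + 1))) := by
  induction ha using Subgroup.closure_induction with
  | mem a ha =>
    obtain ⟨k, hk, t, w, σ, -, rfl⟩ := ha
    rw [S.toPerm_word htrans, sidePerm_self, wordPerm_cons]
    by_cases hki : i = k
    · subst hki
      rw [nodePerm_node, wordPerm_root]
    · rw [nodePerm_node_ne hki]
  | one => simp
  | mul a b _ _ h h' => rw [map_mul, Equiv.Perm.mul_apply, h', h]
  | inv a _ h => rw [map_inv, Equiv.Perm.inv_eq_iff_eq, h]

/-- Elements of different branches commute, so one branch at a time can be split off. Its factor is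
conjugate to an element of the opposite side with shorter words, to which `hn` applies. -/
theorem eq_one_of_mem_closure_branchSet (htrans : ∀ j, MulAction.IsPretransitive (Γ j) (I j))
    {j : Fin 2} {n : ℕ}
    (hn : ∀ g ∈ Subgroup.closure (S.wordSet (j + 1) n), S.toPerm g = 1 → g = 1)
    (F : Finset (Punctured ι j)) {a : G}
    (ha : a ∈ Subgroup.closure (S.branchSet (F : Set (Punctured ι j)) n))
    (h : S.toPerm a = 1) : a = 1 := by
  classical
  induction F using Finset.induction_on generalizing a with
  | empty =>
    have : S.branchSet ((∅ : Finset (Punctured ι j)) : Set (Punctured ι j)) n = ∅ := by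
      simp [branchSet]
    rwa [this, Subgroup.closure_empty, Subgroup.mem_bot] at ha
  | insert i F hi ih =>
    have hsub : S.branchSet ((insert i F : Finset _) : Set (Punctured ι j)) n ⊆
        S.branchSet {i} n ∪ S.branchSet (F : Set (Punctured ι j)) n := by
      rintro _ ⟨k, hk, t, w, σ, hw, rfl⟩
      rcases Finset.mem_insert.mp (Finset.mem_coe.mp hk) with hk | hk
      · exact Or.inl ⟨k, hk, t, w, σ, hw, rfl⟩
      · exact Or.inr ⟨k, hk, t, w, σ, hw, rfl⟩
    obtain ⟨b, hb, c, hc, rfl⟩ := Subgroup.exists_mul_of_mem_closure_union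
      (fun a ha b hb => S.commute_branchSet htrans (by simpa using hi) ha hb)
      (Subgroup.closure_mono hsub ha)
    obtain ⟨p, hp⟩ := S.exists_toPerm_eq_nodePerm htrans hb
    -- The factor `c` fixes the branch `i` pointwise, so there the product acts as `p`.
    have hp1 : p = 1 := by
      ext1 x
      have hx := DFunLike.congr_fun h (of j (HalfTree.node i x))
      rw [map_mul, Equiv.Perm.mul_apply, S.toPerm_branch_of_notMem htrans (by simpa using hi) hc,
        hp, sidePerm_self, nodePerm_node, Equiv.Perm.one_apply, of_inj, node_inj] at hx
      exact hx.2
    have hb1 : S.toPerm b = 1 := by rw [hp, hp1, map_one, map_one]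
    have hc1 : S.toPerm c = 1 := by rwa [map_mul, hb1, one_mul] at h
    obtain ⟨ρ, hρ⟩ := exists_rot htrans i.1 (ι j)
    have := hn _ (S.conj_mem_closure_wordSet hρ hb) (by simp [hb1])
    rw [conj_eq_one_iff] at this
    rw [this, ih hc hc1, one_mul]

theorem exists_finset_mem_closure_branchSet {j : Fin 2} {n : ℕ} {a : G}
    (ha : a ∈ Subgroup.closure (S.branchSet (Set.univ : Set (Punctured ι j)) n)) :
    ∃ F : Finset (Punctured ι j),
      a ∈ Subgroup.closure (S.branchSet (F : Set (Punctured ι j)) n) := by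
  classical
  induction ha using Subgroup.closure_induction with
  | mem a ha =>
    obtain ⟨i, -, t, w, σ, hw, rfl⟩ := ha
    exact ⟨{i}, Subgroup.subset_closure ⟨i, by simp, t, w, σ, hw, rfl⟩⟩
  | one => exact ⟨∅, one_mem _⟩
  | mul a b _ _ h h' =>
    obtain ⟨F, h⟩ := h
    obtain ⟨F', h'⟩ := h'
    exact ⟨F ∪ F', mul_mem
      (Subgroup.closure_mono (S.branchSet_mono (by simp) n) h)
      (Subgroup.closure_mono (S.branchSet_mono (by simp) n) h')⟩
  | inv a _ h => exact h.imp fun _ => inv_mem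

theorem conj_mem_closure_branchSet {j : Fin 2} (σ : stab ι Γ j) {n : ℕ} {a : G}
    (ha : a ∈ Subgroup.closure (S.branchSet (Set.univ : Set (Punctured ι j)) n)) :
    S.word (.nil j) σ * a * (S.word (.nil j) σ)⁻¹ ∈
      Subgroup.closure (S.branchSet (Set.univ : Set (Punctured ι j)) n) := by
  have hle : Subgroup.closure (S.branchSet (Set.univ : Set (Punctured ι j)) n) ≤
      (Subgroup.closure (S.branchSet (Set.univ : Set (Punctured ι j)) n)).comap
        (MulAut.conj (S.word (.nil j) σ)).toMonoidHom := by
    rw [Subgroup.closure_le]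
    rintro _ ⟨i, -, t, w, τ, hw, rfl⟩
    refine Subgroup.subset_closure ⟨stabPerm Γ j σ i, trivial, t, w, τ, hw, ?_⟩
    change S.word (.nil j) σ * _ * (S.word (.nil j) σ)⁻¹ = _
    rw [S.word_nil]
    exact S.conj_ne _ _ _ rfl w τ
  exact hle ha

/-- The rotations around the root normalize the subgroup generated by the branches, so they can be
collected on the right. -/
theorem exists_mul_of_mem_closure_wordSet {j : Fin 2} {n : ℕ} {g : G}
    (hg : g ∈ Subgroup.closure (S.wordSet j (n + 1))) :
    ∃ a ∈ Subgroup.closure (S.branchSet (Set.univ : Set (Punctured ι j)) n), ∃ σ : stab ι Γ j,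
      g = a * S.word (.nil j) σ := by
  have hmul : ∀ σ τ : stab ι Γ j,
      S.word (.nil j) σ * S.word (.nil j) τ = S.word (.nil j) (σ * τ) := by
    intro σ τ
    rw [S.word_nil, S.word_nil, S.word_nil, map_mul, map_mul]
  have hinv : ∀ σ : stab ι Γ j, (S.word (.nil j) σ)⁻¹ = S.word (.nil j) σ⁻¹ := by
    intro σ
    rw [S.word_nil, S.word_nil, map_inv, map_inv]
  have hnil : ∀ (σ : stab ι Γ j) (y : G),
      (∃ a ∈ Subgroup.closure (S.branchSet (Set.univ : Set (Punctured ι j)) n), ∃ τ : stab ι Γ j,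
        y = a * S.word (.nil j) τ) →
      ∃ a ∈ Subgroup.closure (S.branchSet (Set.univ : Set (Punctured ι j)) n), ∃ τ : stab ι Γ j,
        S.word (.nil j) σ * y = a * S.word (.nil j) τ := by
    rintro σ _ ⟨a, ha, τ, rfl⟩
    refine ⟨_, S.conj_mem_closure_branchSet σ ha, σ * τ, ?_⟩
    rw [← hmul]
    group
  induction hg using Subgroup.closure_induction_left with
  | one => exact ⟨1, one_mem _, 1, by rw [S.word_nil, map_one, map_one, mul_one]⟩
  | mul_left x hx y _ hy =>
    obtain ⟨t, w, σ, hw, rfl⟩ := hx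
    cases w with
    | nil => exact hnil σ y hy
    | cons i w =>
      obtain ⟨a, ha, τ, rfl⟩ := hy
      refine ⟨S.word (.cons i w) σ * a, mul_mem (Subgroup.subset_closure
        ⟨i, trivial, t, w, σ, Nat.lt_of_succ_lt_succ hw, rfl⟩) ha, τ, ?_⟩
      rw [mul_assoc]
  | inv_mul_cancel x hx y _ hy =>
    obtain ⟨t, w, σ, hw, rfl⟩ := hx
    cases w with
    | nil =>
      rw [hinv]
      exact hnil σ⁻¹ y hy
    | cons i w =>
      obtain ⟨a, ha, τ, rfl⟩ := hy
      refine ⟨(S.word (.cons i w) σ)⁻¹ * a, mul_mem (inv_mem (Subgroup.subset_closure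
        ⟨i, trivial, t, w, σ, Nat.lt_of_succ_lt_succ hw, rfl⟩)) ha, τ, ?_⟩
      rw [mul_assoc]

/-- Induction on the length bound: the rotation around the root is visible on the neighbours of the
root, and what remains splits into finitely many branches with shorter words. -/
theorem eq_one_of_mem_closure_wordSet (htrans : ∀ j, MulAction.IsPretransitive (Γ j) (I j))
    {j : Fin 2} {n : ℕ} {g : G} (hg : g ∈ Subgroup.closure (S.wordSet j n))
    (h : S.toPerm g = 1) : g = 1 := by
  induction n generalizing j g with
  | zero =>
    have : S.wordSet j 0 = ∅ := by simp [wordSet]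
    rwa [this, Subgroup.closure_empty, Subgroup.mem_bot] at hg
  | succ n ih =>
    obtain ⟨a, ha, σ, rfl⟩ := S.exists_mul_of_mem_closure_wordSet hg
    have hσ : σ = 1 := by
      have hfix : ∀ i : Punctured ι j, (σ : Equiv.Perm (I j)) i.1 = i.1 := by
        intro i
        have hi := DFunLike.congr_fun h (of j (HalfTree.node i (root (j + 1))))
        rw [map_mul, Equiv.Perm.mul_apply, S.toPerm_word htrans, sidePerm_self, wordPerm_nil,
          rootPerm_node, S.toPerm_branch_root htrans ha, Equiv.Perm.one_apply, of_inj,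
          node_inj] at hi
        exact congrArg Subtype.val hi.1
      ext i
      by_cases hi : i = ι j
      · rw [hi]
        exact stab_apply Γ σ
      · exact hfix ⟨i, hi⟩
    have hnil : S.word (.nil j) σ = 1 := by rw [hσ, S.word_nil, map_one, map_one]
    rw [hnil, mul_one] at h ⊢
    obtain ⟨F, hF⟩ := S.exists_finset_mem_closure_branchSet ha
    exact S.eq_one_of_mem_closure_branchSet htrans (fun g hg h => ih hg h) F hF h

/-- The elements `word w σ` for words that start at index `j`. -/
def sideSet (j : Fin 2) : Set G :=
  {g | ∃ (t : Fin 2) (w : Word ι j t) (σ : stab ι Γ t), g = S.word w σ}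

theorem exists_mem_closure_wordSet {j : Fin 2} {g : G}
    (hg : g ∈ Subgroup.closure (S.sideSet j)) : ∃ n, g ∈ Subgroup.closure (S.wordSet j n) := by
  have hmono : ∀ {m n}, m ≤ n → S.wordSet j m ⊆ S.wordSet j n := by
    rintro m n hmn _ ⟨t, w, σ, hw, rfl⟩
    exact ⟨t, w, σ, hw.trans_le hmn, rfl⟩
  induction hg using Subgroup.closure_induction with
  | mem g hg =>
    obtain ⟨t, w, σ, rfl⟩ := hg
    exact ⟨_, Subgroup.subset_closure ⟨t, w, σ, Nat.lt_succ_self _, rfl⟩⟩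
  | one => exact ⟨0, one_mem _⟩
  | mul a b _ _ h h' =>
    obtain ⟨m, h⟩ := h
    obtain ⟨n, h'⟩ := h'
    exact ⟨max m n, mul_mem (Subgroup.closure_mono (hmono (le_max_left _ _)) h)
      (Subgroup.closure_mono (hmono (le_max_right _ _)) h')⟩
  | inv a _ h => exact h.imp fun _ => inv_mem

/-- The image of the edge group. -/
def edgeSubgroup : Subgroup G :=
  Subgroup.closure {g | ∃ (j t : Fin 2) (w : Word ι j t) (σ : stab ι Γ t), g = S.word w σ}

theorem word_mem_edgeSubgroup {j t : Fin 2} (w : Word ι j t) (σ : stab ι Γ t) :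
    S.word w σ ∈ S.edgeSubgroup :=
  Subgroup.subset_closure ⟨j, t, w, σ, rfl⟩

theorem exists_mul_of_mem_edgeSubgroup {g : G} (hg : g ∈ S.edgeSubgroup) :
    ∃ a ∈ Subgroup.closure (S.sideSet 0), ∃ b ∈ Subgroup.closure (S.sideSet 1), g = a * b := by
  apply Subgroup.exists_mul_of_mem_closure_union
  · rintro _ ⟨t, w, σ, rfl⟩ _ ⟨r, v, τ, rfl⟩
    exact S.commute_word (by decide) _ _ _ _
  · refine Subgroup.closure_mono ?_ hg
    rintro _ ⟨j, t, w, σ, rfl⟩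
    rcases fin_two_eq_or 0 j with rfl | rfl
    · exact Or.inl ⟨t, w, σ, rfl⟩
    · exact Or.inr ⟨t, w, σ, rfl⟩

/-- The two commuting factors act on complementary half trees, so each of them acts trivially. -/
theorem eq_one_of_mem_edgeSubgroup (htrans : ∀ j, MulAction.IsPretransitive (Γ j) (I j))
    {g : G} (hg : g ∈ S.edgeSubgroup) (h : S.toPerm g = 1) : g = 1 := by
  obtain ⟨a, ha, b, hb, rfl⟩ := S.exists_mul_of_mem_edgeSubgroup hg
  obtain ⟨m, ha⟩ := S.exists_mem_closure_wordSet ha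
  obtain ⟨n, hb⟩ := S.exists_mem_closure_wordSet hb
  obtain ⟨p, hp⟩ := S.exists_toPerm_eq_sidePerm htrans ha
  obtain ⟨q, hq⟩ := S.exists_toPerm_eq_sidePerm htrans hb
  have hp1 : p = 1 := by
    ext1 x
    have hx := DFunLike.congr_fun h (of 0 x)
    rwa [map_mul, Equiv.Perm.mul_apply, hp, hq, sidePerm_ne (by decide), sidePerm_self,
      Equiv.Perm.one_apply, of_inj] at hx
  have ha1 : S.toPerm a = 1 := by rw [hp, hp1, map_one]
  have hb1 : S.toPerm b = 1 := by rwa [map_mul, ha1, one_mul] at h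
  rw [S.eq_one_of_mem_closure_wordSet htrans ha ha1, S.eq_one_of_mem_closure_wordSet htrans hb hb1,
    one_mul]

theorem toPerm_of_mem_edgeSubgroup (htrans : ∀ j, MulAction.IsPretransitive (Γ j) (I j))
    {g : G} (hg : g ∈ S.edgeSubgroup) {j : Fin 2} {v : Vertex ι} (hv : v ∈ side ι j) :
    S.toPerm g v ∈ side ι j := by
  have key : ∀ p : Equiv.Perm (Vertex ι), (∃ k q, p = sidePerm k q) → ∀ v ∈ side ι j,
      p v ∈ side ι j := by
    rintro _ ⟨k, q, rfl⟩ _ ⟨x, rfl⟩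
    by_cases hk : j = k
    · subst hk
      exact ⟨q x, (sidePerm_self _ _).symm⟩
    · exact ⟨x, (sidePerm_ne hk _ _).symm⟩
  induction hg using Subgroup.closure_induction_left generalizing v with
  | one => simpa using hv
  | mul_left x hx y _ hy =>
    obtain ⟨k, t, w, σ, rfl⟩ := hx
    rw [map_mul, Equiv.Perm.mul_apply]
    exact key _ ⟨k, _, S.toPerm_word htrans _ _⟩ _ (hy hv)
  | inv_mul_cancel x hx y _ hy =>
    obtain ⟨k, t, w, σ, rfl⟩ := hx
    rw [map_mul, Equiv.Perm.mul_apply]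
    exact key _ ⟨k, _, by rw [map_inv, S.toPerm_word htrans, map_inv]⟩ _ (hy hv)

theorem rot_mem_edgeSubgroup {j : Fin 2} {σ : Γ j} (hσ : (σ : Equiv.Perm (I j)) (ι j) = ι j) :
    S.rot j σ ∈ S.edgeSubgroup := by
  have := S.word_mem_edgeSubgroup (.nil j) ⟨σ.1, σ.2, hσ⟩
  rwa [S.word_nil] at this

/-- A rotation around `base j` conjugates the generators of the edge group into the edge group,
except possibly those that are themselves rotations around `base j`. -/
theorem conj_word_mem_edgeSubgroup {j k t : Fin 2} (w : Word ι k t) (τ : stab ι Γ t) (σ : Γ j) :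
    (∃ ρ : Γ j, (ρ : Equiv.Perm (I j)) (ι j) = ι j ∧ S.word w τ = S.rot j ρ) ∨
      (S.rot j σ)⁻¹ * S.word w τ * S.rot j σ ∈ S.edgeSubgroup := by
  rcases fin_two_eq_or j k with rfl | rfl
  · cases w with
    | nil => exact Or.inl ⟨_, stab_apply Γ τ, S.word_nil _ τ⟩
    | cons i w =>
      right
      have hconj : (S.rot k σ)⁻¹ * S.word (.cons i w) τ * S.rot k σ =
          S.rot k σ⁻¹ * S.word (.cons i w) τ * (S.rot k σ⁻¹)⁻¹ := by rw [map_inv, inv_inv]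
      rw [hconj]
      by_cases hi : ((σ⁻¹ : Γ k) : Equiv.Perm (I k)) i.1 = ι k
      · rw [S.conj_base _ i hi]
        exact S.word_mem_edgeSubgroup _ _
      · rw [S.conj_ne _ i ⟨_, hi⟩ rfl]
        exact S.word_mem_edgeSubgroup _ _
  · right
    by_cases hi : (σ : Equiv.Perm (I j)) (ι j) = ι j
    · exact mul_mem (mul_mem (inv_mem (S.rot_mem_edgeSubgroup hi)) (S.word_mem_edgeSubgroup _ _))
        (S.rot_mem_edgeSubgroup hi)
    · have hne : (σ : Equiv.Perm (I j))⁻¹ (ι j) ≠ ι j := by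
        rwa [Ne, Equiv.Perm.inv_eq_iff_eq, eq_comm]
      have := S.conj_base σ ⟨_, hne⟩ (Equiv.apply_symm_apply _ _) w τ
      rw [← this]
      have h2 := S.word_mem_edgeSubgroup (.cons (⟨_, hne⟩ : Punctured ι j) w) τ
      convert h2 using 1
      group

/-- An edge element can be pushed past a rotation; the rotations around `base j` among its
generators are merged into `τ`. Since `τ` fixes `ι j`, whether the rotation moves `ι j` does not
change. -/
theorem exists_mul_rot_eq {j : Fin 2} {m : G} (hm : m ∈ S.edgeSubgroup) (σ : Γ j) :
    ∃ τ : Γ j, (τ : Equiv.Perm (I j)) (ι j) = ι j ∧ ∃ m' ∈ S.edgeSubgroup,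
      m * S.rot j σ = S.rot j (τ * σ) * m' := by
  induction hm using Subgroup.closure_induction_left with
  | one => exact ⟨1, rfl, 1, one_mem _, by simp⟩
  | mul_left x hx y _ hy =>
    obtain ⟨k, t, w, ρ, rfl⟩ := hx
    obtain ⟨τ, hτ, m, hm, h⟩ := hy
    rw [mul_assoc, h]
    rcases S.conj_word_mem_edgeSubgroup w ρ (τ * σ) with ⟨π, hπ, hw⟩ | hw
    · refine ⟨π * τ, by simp [hτ, hπ], m, hm, ?_⟩
      rw [hw, mul_assoc, map_mul (S.rot j) π, mul_assoc]
    · refine ⟨τ, hτ, _, mul_mem hw hm, ?_⟩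
      group
  | inv_mul_cancel x hx y _ hy =>
    obtain ⟨k, t, w, ρ, rfl⟩ := hx
    obtain ⟨τ, hτ, m, hm, h⟩ := hy
    rw [mul_assoc, h]
    rcases S.conj_word_mem_edgeSubgroup w ρ (τ * σ) with ⟨π, hπ, hw⟩ | hw
    · refine ⟨π⁻¹ * τ, ?_, m, hm, ?_⟩
      · have : (π : Equiv.Perm (I j))⁻¹ (ι j) = ι j := by rw [Equiv.Perm.inv_eq_iff_eq, hπ]
        rw [Subgroup.coe_mul, Subgroup.coe_inv, Equiv.Perm.mul_apply, hτ, this]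
      · rw [hw, mul_assoc, map_mul (S.rot j) π⁻¹, map_inv, mul_assoc]
    · refine ⟨τ, hτ, _, mul_mem (inv_mem hw) hm, ?_⟩
      group

/-! ### Reduced words -/

/-- `Reduced j g` says that `g` is represented by a nonempty reduced word that starts with a
rotation around `base j`. -/
inductive Reduced : Fin 2 → G → Prop
  | single {j : Fin 2} (σ : Γ j) (hσ : (σ : Equiv.Perm (I j)) (ι j) ≠ ι j) {m : G}
      (hm : m ∈ S.edgeSubgroup) : Reduced j (S.rot j σ * m)
  | cons {j : Fin 2} (σ : Γ j) (hσ : (σ : Equiv.Perm (I j)) (ι j) ≠ ι j) {m g : G}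
      (hm : m ∈ S.edgeSubgroup) (hg : Reduced (j + 1) g) : Reduced j (S.rot j σ * m * g)

variable {S}

theorem Reduced.mul_left {j : Fin 2} {g : G} (hg : S.Reduced j g) {m : G}
    (hm : m ∈ S.edgeSubgroup) : S.Reduced j (m * g) := by
  have key : ∀ τ σ : Γ j, (τ : Equiv.Perm (I j)) (ι j) = ι j →
      (σ : Equiv.Perm (I j)) (ι j) ≠ ι j → ((τ * σ : Γ j) : Equiv.Perm (I j)) (ι j) ≠ ι j := by
    intro τ σ hτ hσ hc
    exact hσ (τ.1.injective (hc.trans hτ.symm))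
  cases hg with
  | single σ hσ hm' =>
    obtain ⟨τ, hτ, m₁, hm₁, h⟩ := S.exists_mul_rot_eq hm σ
    rw [← mul_assoc, h, mul_assoc]
    exact .single _ (key τ σ hτ hσ) (mul_mem hm₁ hm')
  | cons σ hσ hm' hg =>
    obtain ⟨τ, hτ, m₁, hm₁, h⟩ := S.exists_mul_rot_eq hm σ
    rw [← mul_assoc, ← mul_assoc, h, mul_assoc (S.rot j (τ * σ))]
    exact .cons _ (key τ σ hτ hσ) (mul_mem hm₁ hm') hg

variable (S)

/-- The union of these two classes contains 1 and is closed under left multiplication by rotations,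
which generate the group. -/
theorem mem_edgeSubgroup_or_reduced (g : G) : g ∈ S.edgeSubgroup ∨ ∃ j, S.Reduced j g := by
  induction g using S.induction with
  | one => exact Or.inl (one_mem _)
  | mul j σ g hg =>
    by_cases hσ : (σ : Equiv.Perm (I j)) (ι j) = ι j
    · rcases hg with hg | ⟨k, hg⟩
      · exact Or.inl (mul_mem (S.rot_mem_edgeSubgroup hσ) hg)
      · exact Or.inr ⟨k, hg.mul_left (S.rot_mem_edgeSubgroup hσ)⟩
    · rcases hg with hg | ⟨k, hg⟩
      · exact Or.inr ⟨j, .single σ hσ hg⟩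
      · rcases fin_two_eq_or j k with rfl | rfl
        -- Two rotations around the same vertex merge. If the product fixes `ι k`, it is absorbed
        -- into the edge group and the word becomes shorter.
        · cases hg with
          | single τ hτ hm =>
            rw [← mul_assoc, ← map_mul]
            by_cases h : ((σ * τ : Γ k) : Equiv.Perm (I k)) (ι k) = ι k
            · exact Or.inl (mul_mem (S.rot_mem_edgeSubgroup h) hm)
            · exact Or.inr ⟨k, .single _ h hm⟩
          | cons τ hτ hm hg =>
            rw [← mul_assoc, ← mul_assoc, ← map_mul]
            by_cases h : ((σ * τ : Γ k) : Equiv.Perm (I k)) (ι k) = ι k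
            · exact Or.inr ⟨_, hg.mul_left (mul_mem (S.rot_mem_edgeSubgroup h) hm)⟩
            · exact Or.inr ⟨k, .cons _ h hm hg⟩
        · refine Or.inr ⟨j, ?_⟩
          have := Reduced.cons σ hσ (one_mem S.edgeSubgroup) hg
          rwa [mul_one] at this

variable {S}

theorem toPerm_rot_mem {j : Fin 2} {σ : Γ j} (hσ : (σ : Equiv.Perm (I j)) (ι j) ≠ ι j)
    {v : Vertex ι} (hv : v ∈ side ι (j + 1)) :
    ∃ x, S.toPerm (S.rot j σ) v =
      of j (HalfTree.node ⟨(σ : Equiv.Perm (I j)) (ι j), hσ⟩ x) := by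
  obtain ⟨x, rfl⟩ := hv
  refine ⟨x, ?_⟩
  rw [S.toPerm_rot, ← branch_base, rotPerm_branch, ← branch_punctured]

/-- Each rotation that moves `ι j` throws the opposite half tree into a branch on its own side, and
the edge elements in between preserve sides. So `k` is the side opposite to the last rotation. -/
theorem Reduced.exists_toPerm_eq (htrans : ∀ j, MulAction.IsPretransitive (Γ j) (I j))
    {j : Fin 2} {g : G} (hg : S.Reduced j g) :
    ∃ k, ∀ v ∈ side ι k, ∃ (i : Punctured ι j) (x : HalfTree ι (j + 1)),
      S.toPerm g v = of j (HalfTree.node i x) := by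
  induction hg with
  | @single j σ hσ m hm =>
    refine ⟨j + 1, fun v hv => ⟨⟨_, hσ⟩, ?_⟩⟩
    rw [map_mul, Equiv.Perm.mul_apply]
    exact toPerm_rot_mem hσ (S.toPerm_of_mem_edgeSubgroup htrans hm hv)
  | @cons j σ hσ m g hm _ ih =>
    obtain ⟨k, ih⟩ := ih
    refine ⟨k, fun v hv => ⟨⟨_, hσ⟩, ?_⟩⟩
    rw [map_mul, Equiv.Perm.mul_apply, map_mul, Equiv.Perm.mul_apply]
    refine toPerm_rot_mem hσ (S.toPerm_of_mem_edgeSubgroup htrans hm ?_)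
    obtain ⟨i, x, hx⟩ := ih v hv
    exact ⟨_, hx.symm⟩

variable (S)

/-- A reduced element sends some base to a vertex that is not a base, so it does not act trivially.
-/
theorem toPerm_injective (htrans : ∀ j, MulAction.IsPretransitive (Γ j) (I j)) :
    Function.Injective S.toPerm := by
  rw [injective_iff_map_eq_one]
  intro g h
  rcases S.mem_edgeSubgroup_or_reduced g with hg | ⟨j, hg⟩
  · exact S.eq_one_of_mem_edgeSubgroup htrans hg h
  · obtain ⟨k, hk⟩ := hg.exists_toPerm_eq htrans
    obtain ⟨i, x, hx⟩ := hk (base ι k) ⟨_, rfl⟩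
    rw [h, Equiv.Perm.one_apply] at hx
    exact absurd hx (of_root_ne_of_node i x)

end RotationSystem

end Amalgam

/-! ### Ping-pong -/

section PingPong

open scoped Pointwise

/-- The element `x * y` maps `B` into `x • A`, which is disjoint from `x' • A`. Cancelling the
common power `(x * y) ^ i` leaves `x' • A` on one side and a subset of `x • A` on the other. -/
theorem disjoint_smul_of_pingPong {G : Type*} [Group G] {V : Type*} [MulAction G V]
    {A B : Set V} {x x' y : G} (hx : x • A ⊆ B) (hx' : x' • A ⊆ B) (hy : y • B ⊆ A)
    (hd : Disjoint (x • A) (x' • A)) {i j : ℕ} (hij : i < j) :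
    Disjoint (((x * y) ^ i * x') • A) (((x * y) ^ j * x') • A) := by
  have key : ∀ n : ℕ, ((x * y) ^ n * x') • A ⊆ B := by
    intro n
    induction n with
    | zero => simpa using hx'
    | succ n ih =>
      rw [pow_succ', mul_assoc, mul_smul, mul_smul]
      exact (Set.smul_set_mono ((Set.smul_set_mono ih).trans hy)).trans hx
  obtain ⟨d, rfl⟩ := Nat.exists_eq_add_of_lt hij
  rw [add_assoc, pow_add, mul_assoc, mul_smul, mul_smul ((x * y) ^ i), Set.disjoint_smul_set]
  refine hd.symm.mono_right ?_
  rw [pow_succ', mul_assoc, mul_smul, mul_smul]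
  exact Set.smul_set_mono ((Set.smul_set_mono (key d)).trans hy)

end PingPong

/-! ### Disjoint translates of half trees, and the amalgam -/

namespace Amalgam

variable {I : Fin 2 → Type u} {ι : ∀ j, I j}

open HalfTree Vertex

variable {Γ : ∀ j, Subgroup (Equiv.Perm (I j))}

/-- A point moved by the stabilizer and its image both differ from `ι j`. These two labels give the
disjoint branches needed for ping-pong. -/
theorem exists_ne_of_stab_ne_bot {j : Fin 2} (h : stab ι Γ j ≠ ⊥) :
    ∃ i k : Punctured ι j, i ≠ k := by
  obtain ⟨σ, hσ⟩ := (Subgroup.ne_bot_iff_exists_ne_one (H := stab ι Γ j)).mp h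
  obtain ⟨i, hi⟩ : ∃ i, (σ : Equiv.Perm (I j)) i ≠ i := by
    by_contra! hc
    exact hσ (Subtype.ext (Equiv.ext hc))
  have hi' : i ≠ ι j := fun hc => hi (hc ▸ stab_apply Γ σ)
  exact ⟨⟨i, hi'⟩, stabPerm Γ j σ ⟨i, hi'⟩, fun hc => hi (congrArg Subtype.val hc).symm⟩

open scoped Pointwise in
theorem RotationSystem.not_innerAmenable {G : Type*} [Group G] (S : RotationSystem ι Γ G)
    (hI : ∀ j, Nonempty (Punctured ι j))
    (htrans : ∀ j, MulAction.IsPretransitive (Γ j) (I j))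
    (hstab : ∃ j, stab ι Γ j ≠ ⊥) : ¬ InnerAmenable G := by
  obtain ⟨j, hj⟩ := hstab
  obtain ⟨k, k', hk⟩ := exists_ne_of_stab_ne_bot hj
  obtain ⟨l⟩ := hI (j + 1)
  obtain ⟨x, hx⟩ := exists_rot htrans (ι j) k.1
  obtain ⟨x', hx'⟩ := exists_rot htrans (ι j) k'.1
  obtain ⟨y, hy⟩ := exists_rot htrans (ι (j + 1)) l.1
  let _ : MulAction G (Vertex ι) := MulAction.compHom _ S.toPerm
  have hsmul : ∀ (g : G) (v : Vertex ι), g • v = S.toPerm g v := fun _ _ => rfl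
  have : FaithfulSMul G (Vertex ι) :=
    ⟨fun h => S.toPerm_injective htrans (Equiv.ext h)⟩
  have hrot : ∀ {j : Fin 2} (σ : Γ j) (i : Punctured ι j), (σ : Equiv.Perm (I j)) (ι j) = i.1 →
      ∀ z, S.rot j σ • of (j + 1) z = of j (HalfTree.node i z) := by
    intro j σ i hσ z
    rw [hsmul, S.toPerm_rot, ← branch_base, rotPerm_branch, hσ, branch_punctured]
  have hX : ∀ {j : Fin 2} (σ : Γ j) (i : Punctured ι j), (σ : Equiv.Perm (I j)) (ι j) = i.1 →
      S.rot j σ • side ι (j + 1) ⊆ side ι j := by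
    rintro j σ i hσ _ ⟨_, ⟨z, rfl⟩, rfl⟩
    exact ⟨_, (hrot σ i hσ z).symm⟩
  have hY : S.rot (j + 1) y • side ι j ⊆ side ι (j + 1) := by
    have := hX y l hy
    rwa [add_one_add_one] at this
  have hd : Disjoint (S.rot j x • side ι (j + 1)) (S.rot j x' • side ι (j + 1)) := by
    rw [Set.disjoint_left]
    rintro _ ⟨_, ⟨z, rfl⟩, rfl⟩ ⟨_, ⟨z', rfl⟩, h⟩
    have h : S.rot j x' • of (j + 1) z' = S.rot j x • of (j + 1) z := h
    rw [hrot x k hx, hrot x' k' hx', of_inj, node_inj] at h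
    exact hk h.1.symm
  have hpp := fun i n (hin : i < n) =>
    disjoint_smul_of_pingPong (hX x k hx) (hX x' k' hx') hY hd hin
  refine not_innerAmenable_of_tree_action (T := tree ι) (U := side ι (j + 1))
    (a := base ι (j + 1)) (b := base ι j) tree_connected (fun g v w h => S.adj_toPerm g h)
    (fun g => (S.finite_singularSet g).subset ?_) ⟨_, rfl⟩ ?_
    (fun v hv w hw h => eq_base_of_adj hv hw h) (tree_adj_base j).symm (fun g hg => ?_)
    (fun n => (S.rot j x * S.rot (j + 1) y) ^ n * S.rot j x')
    (fun n => (S.rot j x * S.rot (j + 1) y) ^ n * S.rot j x' * S.rot (j + 1) y) hpp ?_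
  · rintro v ⟨hv, w, hvw, hw⟩
    exact mem_singularSet hv hvw hw
  · rw [← Set.mem_compl_iff, compl_side_add_one]
    exact ⟨_, rfl⟩
  · have := S.type_toPerm g (base ι (j + 1))
    rw [← hsmul, hg, type_base, type_base] at this
    exact fin_two_ne_add_one j this
  -- The additional factor first moves the complement `side ι j` into `side ι (j + 1)`, whose
  -- translates are already known to be disjoint.
  · intro i n hin
    rw [compl_side_add_one, mul_smul _ (S.rot (j + 1) y), mul_smul _ (S.rot (j + 1) y)]
    exact (hpp i n hin).mono (Set.smul_set_mono hY) (Set.smul_set_mono hY)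

/-! ### The amalgam -/

variable (ι Γ)

theorem vertexPerm_self (j : Fin 2) : vertexPerm ι Γ j j = Γ j := if_pos rfl

theorem Rel.mk_eq {A : ∀ j, Subgroup (Equiv.Perm (I j))} {a b : FreeGroup (Gen ι Γ A)}
    (h : Rel ι Γ A a b) : PresentedGroup.mk (rels ι Γ A) a = PresentedGroup.mk (rels ι Γ A) b := by
  rw [← mul_inv_eq_one, ← map_inv, ← map_mul]
  exact PresentedGroup.one_of_mem ⟨a, b, h, rfl⟩

/-- The element `g_j(σ)` of a group given by the generators and relations. -/
def rotGrp (A : ∀ j, Subgroup (Equiv.Perm (I j))) (j : Fin 2) : A j →* Grp ι Γ A :=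
  MonoidHom.mk' (fun σ => PresentedGroup.mk _ (gF ι Γ A j σ)) fun σ τ => by
    rw [← map_mul, (Rel.r5_mul j σ τ).mk_eq]

/-- The element `g_j(σ)` of a group given by the generators and relations if the word is empty,
and otherwise `h_j(w; σ)`. -/
def wordGrp (A : ∀ j, Subgroup (Equiv.Perm (I j))) (hA : ∀ j, stab ι Γ j ≤ A j) :
    ∀ {j t : Fin 2}, Word ι j t → stab ι Γ t → Grp ι Γ A
  | _, _, .nil j, σ => rotGrp ι Γ A j (Subgroup.inclusion (hA j) σ)
  | _, _, .cons i w, σ => PresentedGroup.mk _ (hF ι Γ A _ i w σ)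

/-- The generator of `Q_j` that `wordGrp` is the image of. -/
def wordGen (A : ∀ j, Subgroup (Equiv.Perm (I j))) (hA : ∀ j, stab ι Γ j ≤ A j) :
    ∀ {j t : Fin 2}, Word ι j t → stab ι Γ t → Gen ι Γ A
  | _, _, .nil j, σ => .g j (Subgroup.inclusion (hA j) σ)
  | _, _, .cons i w, σ => .h _ i w σ

variable {A : ∀ j, Subgroup (Equiv.Perm (I j))} (hA : ∀ j, stab ι Γ j ≤ A j)

theorem wordGrp_eq {j t : Fin 2} (w : Word ι j t) (σ : stab ι Γ t) :
    wordGrp ι Γ A hA w σ = PresentedGroup.of (wordGen ι Γ A hA w σ) := by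
  cases w <;> rfl

theorem inQ_wordGen {j t : Fin 2} (w : Word ι j t) (σ : stab ι Γ t) :
    Gen.InQ ι Γ A j (wordGen ι Γ A hA w σ) := by
  cases w with
  | nil => exact .g _ σ.2
  | cons i w => exact .h i w σ

theorem commute_wordGrp {j k t r : Fin 2} (hjk : j ≠ k) (v : Word ι j t) (w : Word ι k r)
    (σ : stab ι Γ t) (τ : stab ι Γ r) :
    Commute (wordGrp ι Γ A hA v σ) (wordGrp ι Γ A hA w τ) := by
  have key : ∀ {t r : Fin 2} (v : Word ι 0 t) (w : Word ι 1 r) (σ : stab ι Γ t) (τ : stab ι Γ r),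
      Commute (wordGrp ι Γ A hA v σ) (wordGrp ι Γ A hA w τ) := by
    intro t r v w σ τ
    rw [wordGrp_eq, wordGrp_eq]
    have := (Rel.r1 _ _ (inQ_wordGen ι Γ hA v σ) (inQ_wordGen ι Γ hA w τ)).mk_eq
    rwa [map_mul, map_mul] at this
  rcases fin_two_eq_or 0 j with rfl | rfl <;> rcases fin_two_eq_or 0 k with rfl | rfl
  · exact absurd rfl hjk
  · exact key v w σ τ
  · exact (key w v τ σ).symm
  · exact absurd rfl hjk

theorem rotGrp_conj_base {j t : Fin 2} (σ : A j) (i : Punctured ι j)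
    (hi : (σ : Equiv.Perm (I j)) i.1 = ι j) (w : Word ι (j + 1) t) (τ : stab ι Γ t) :
    rotGrp ι Γ A j σ * wordGrp ι Γ A hA (.cons i w) τ * (rotGrp ι Γ A j σ)⁻¹ =
      wordGrp ι Γ A hA w τ := by
  cases w with
  | nil =>
    have := (Rel.r6_nil j σ i hi τ (hA _ τ.2)).mk_eq
    rwa [map_mul, map_mul, map_inv] at this
  | cons k x =>
    have := (Rel.r6_cons j σ i hi k x τ).mk_eq
    rwa [map_mul, map_mul, map_inv] at this

theorem rotGrp_conj_ne {j t : Fin 2} (σ : A j) (i i' : Punctured ι j)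
    (hi : (σ : Equiv.Perm (I j)) i.1 = i'.1) (w : Word ι (j + 1) t) (τ : stab ι Γ t) :
    rotGrp ι Γ A j σ * wordGrp ι Γ A hA (.cons i w) τ * (rotGrp ι Γ A j σ)⁻¹ =
      wordGrp ι Γ A hA (.cons i' w) τ := by
  have := (Rel.r6_ne j σ i i' hi w τ).mk_eq
  rwa [map_mul, map_mul, map_inv] at this

theorem edgeToVertex_wordGrp (k : Fin 2) {j t : Fin 2} (w : Word ι j t) (σ : stab ι Γ t) :
    edgeToVertex ι Γ k (wordGrp ι Γ (stab ι Γ) (fun _ => le_rfl) w σ) =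
      wordGrp ι Γ (vertexPerm ι Γ k) (stab_le_vertexPerm ι Γ k) w σ := by
  rw [wordGrp_eq, wordGrp_eq, edgeToVertex, Grp.incl, PresentedGroup.toGroup.of]
  cases w <;> rfl

/-- The action of the amalgam on the tree. -/
noncomputable def amalgamToPerm : AmalgamGroup ι Γ →* Equiv.Perm (Vertex ι) :=
  Monoid.PushoutI.lift (fun j => Grp.toPerm ι Γ (vertexPerm ι Γ j)) (Grp.toPerm ι Γ (stab ι Γ)) (by
    intro j
    refine PresentedGroup.ext fun a => ?_
    rw [MonoidHom.comp_apply, edgeToVertex, Grp.incl, PresentedGroup.toGroup.of, Grp.toPerm,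
      Grp.toPerm, PresentedGroup.toGroup.of, PresentedGroup.toGroup.of]
    cases a <;> rfl)

theorem toPerm_rotGrp (j : Fin 2) (σ : A j) : Grp.toPerm ι Γ A (rotGrp ι Γ A j σ) = rotPerm ι j σ :=
  PresentedGroup.toGroup.of _

/-- The element `g_j(σ)` of the amalgam. -/
def amalgamRot (j : Fin 2) : Γ j →* AmalgamGroup ι Γ :=
  (Monoid.PushoutI.of j).comp ((rotGrp ι Γ (vertexPerm ι Γ j) j).comp
    (Subgroup.inclusion (vertexPerm_self ι Γ j).ge))

/-- The element `g_j(σ)` of the amalgam if the word is empty, and otherwise `h_j(w; σ)`. -/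
def amalgamWord {j t : Fin 2} (w : Word ι j t) (σ : stab ι Γ t) : AmalgamGroup ι Γ :=
  Monoid.PushoutI.base _ (wordGrp ι Γ (stab ι Γ) (fun _ => le_rfl) w σ)

theorem amalgamWord_eq_of (k : Fin 2) {j t : Fin 2} (w : Word ι j t) (σ : stab ι Γ t) :
    amalgamWord ι Γ w σ = Monoid.PushoutI.of k
      (wordGrp ι Γ (vertexPerm ι Γ k) (stab_le_vertexPerm ι Γ k) w σ) := by
  rw [amalgamWord, ← Monoid.PushoutI.of_apply_eq_base _ k, edgeToVertex_wordGrp]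

theorem amalgamWord_nil (j : Fin 2) (σ : stab ι Γ j) :
    amalgamWord ι Γ (.nil j) σ = amalgamRot ι Γ j (Subgroup.inclusion (stab_le ι Γ j) σ) := by
  rw [amalgamWord_eq_of ι Γ j]
  rfl

theorem amalgamRot_conj_base {j t : Fin 2} (σ : Γ j) (i : Punctured ι j)
    (hi : (σ : Equiv.Perm (I j)) i.1 = ι j) (w : Word ι (j + 1) t) (τ : stab ι Γ t) :
    amalgamRot ι Γ j σ * amalgamWord ι Γ (.cons i w) τ * (amalgamRot ι Γ j σ)⁻¹ =
      amalgamWord ι Γ w τ := by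
  rw [amalgamWord_eq_of ι Γ j, amalgamWord_eq_of ι Γ j, amalgamRot, MonoidHom.comp_apply,
    ← map_inv, ← map_mul, ← map_mul]
  exact congrArg _ (rotGrp_conj_base ι Γ (stab_le_vertexPerm ι Γ j)
    (Subgroup.inclusion (vertexPerm_self ι Γ j).ge σ) i hi w τ)

theorem amalgamRot_conj_ne {j t : Fin 2} (σ : Γ j) (i i' : Punctured ι j)
    (hi : (σ : Equiv.Perm (I j)) i.1 = i'.1) (w : Word ι (j + 1) t) (τ : stab ι Γ t) :
    amalgamRot ι Γ j σ * amalgamWord ι Γ (.cons i w) τ * (amalgamRot ι Γ j σ)⁻¹ =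
      amalgamWord ι Γ (.cons i' w) τ := by
  rw [amalgamWord_eq_of ι Γ j, amalgamWord_eq_of ι Γ j, amalgamRot, MonoidHom.comp_apply,
    ← map_inv, ← map_mul, ← map_mul]
  exact congrArg _ (rotGrp_conj_ne ι Γ (stab_le_vertexPerm ι Γ j)
    (Subgroup.inclusion (vertexPerm_self ι Γ j).ge σ) i i' hi w τ)

/-- By transitivity each $h_j$ is conjugate under a rotation to an element with a shorter word, and
the empty word gives a rotation. -/
theorem closure_amalgamRot (htrans : ∀ j, MulAction.IsPretransitive (Γ j) (I j)) :
    Subgroup.closure {g | ∃ (j : Fin 2) (σ : Γ j), amalgamRot ι Γ j σ = g} = ⊤ := by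
  set K := Subgroup.closure {g | ∃ (j : Fin 2) (σ : Γ j), amalgamRot ι Γ j σ = g} with hK
  have hrot : ∀ (j : Fin 2) (σ : Γ j), amalgamRot ι Γ j σ ∈ K := fun j σ =>
    Subgroup.subset_closure ⟨j, σ, rfl⟩
  have hword : ∀ {j t : Fin 2} (w : Word ι j t) (σ : stab ι Γ t), amalgamWord ι Γ w σ ∈ K := by
    intro j t w σ
    induction w with
    | nil =>
      rw [amalgamWord_nil]
      exact hrot _ _
    | @cons j t i w ih =>
      obtain ⟨ρ, hρ⟩ := RotationSystem.exists_rot htrans i.1 (ι j)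
      have h := ih σ
      rw [← amalgamRot_conj_base ι Γ ρ i hρ] at h
      rwa [K.mul_mem_cancel_right (inv_mem (hrot j ρ)), K.mul_mem_cancel_left (hrot j ρ)] at h
  have hof : ∀ (j : Fin 2) (x : VertexGroup ι Γ j),
      (Monoid.PushoutI.of j x : AmalgamGroup ι Γ) ∈ K := by
    intro j x
    have hle : Subgroup.closure (Set.range (PresentedGroup.of (rels := rels ι Γ (vertexPerm ι Γ j))))
        ≤ K.comap (Monoid.PushoutI.of j) := by
      rw [Subgroup.closure_le]
      rintro _ ⟨a, rfl⟩
      cases a with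
      | g k σ =>
        by_cases hk : k = j
        · subst hk
          exact hrot k ⟨σ.1, (vertexPerm_self ι Γ k).le σ.2⟩
        -- In the vertex group of `j`, a rotation of the other index comes from the edge group.
        · have hσ : σ.1 ∈ stab ι Γ k := by
            have h : vertexPerm ι Γ j k = stab ι Γ k := if_neg hk
            exact h ▸ σ.2
          have := hword (.nil k) ⟨σ.1, hσ⟩
          rwa [amalgamWord_eq_of ι Γ j] at this
      | h k i w σ =>
        have := hword (.cons i w) σ
        rwa [amalgamWord_eq_of ι Γ j] at this
    rw [PresentedGroup.closure_range_of] at hle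
    exact hle (Subgroup.mem_top x)
  rw [Subgroup.eq_top_iff']
  intro g
  induction g using Monoid.PushoutI.induction_on with
  | of j x => exact hof j x
  | base x =>
    rw [← Monoid.PushoutI.of_apply_eq_base _ 0]
    exact hof 0 _
  | mul x y hx hy => exact mul_mem hx hy

/-- The amalgam as a group that is generated by rotations. -/
noncomputable def amalgamSystem (htrans : ∀ j, MulAction.IsPretransitive (Γ j) (I j)) :
    RotationSystem ι Γ (AmalgamGroup ι Γ) where
  rot := amalgamRot ι Γ
  word := amalgamWord ι Γ
  toPerm := amalgamToPerm ι Γ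
  closure_rot := closure_amalgamRot ι Γ htrans
  word_nil := amalgamWord_nil ι Γ
  commute_word hjk v w σ τ := (commute_wordGrp ι Γ _ hjk v w σ τ).map _
  conj_base := amalgamRot_conj_base ι Γ
  conj_ne := amalgamRot_conj_ne ι Γ
  toPerm_rot j σ := by
    rw [amalgamRot, MonoidHom.comp_apply, amalgamToPerm, Monoid.PushoutI.lift_of]
    exact toPerm_rotGrp ι Γ _ _

end Amalgam

theorem mainTheorem6 {I : Fin 2 → Type u} (ι : ∀ j, I j)
    (Γ : ∀ j, Subgroup (Equiv.Perm (I j)))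
    (hI : ∀ j, Nonempty (Amalgam.Punctured ι j))
    (htrans : ∀ j, MulAction.IsPretransitive (Γ j) (I j))
    (hstab : ¬ (Amalgam.stab ι Γ 0 = ⊥ ∧ Amalgam.stab ι Γ 1 = ⊥)) :
    ¬ InnerAmenable (Amalgam.AmalgamGroup ι Γ) := by
  refine (Amalgam.amalgamSystem ι Γ htrans).not_innerAmenable hI htrans ?_
  by_contra! h
  exact hstab ⟨h 0, h 1⟩
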